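/- An \emph{effect algebra} is a set $E$ with constants $0,1$ and a partial binary operation $\oplus$ which is commutative and associative (in the sense that if one side is defined, so is the other, and they agree), such that every $a\in E$ has a unique $a^\perp$ with $a\oplus a^\perp=1$, and $a\oplus 1$ is defined only for $a=0$ (the case $0=1$ is allowed). Write $a\le b$ if $a\oplus c=b$ for some $c$. A morphism $\phi$ of effect algebras satisfies $\phi(1)=1$ and $\phi(a\oplus b)=\phi(a)\oplus\phi(b)$ whenever $a\oplus b$ is defined. An effect algebra is \emph{simplicial} if it is finite and has the Riesz decomposition property ($a\le b_1\oplus b_2$ implies $a=a_1\oplus a_2$ with $a_i\le b_i$), and a \emph{dimension effect algebra} is a direct limit, in the category of effect algebras, of a directed system of simplicial effect algebras. For a partially ordered abelian group $G$ and $0\le u\in G$, the interval $[0,u]=\{x\in G: 0\le x\le u\}$ is an effect algebra, in which $x\oplus y$ is defined iff $x+y\le u$, and then equals $x+y$. A \emph{universal group} of $E$ is a directed partially ordered abelian group $G_E$ with an element $u_E\ge 0$ and an isomorphism $\iota_E:E\to[0,u_E]$ such that every positive element of $G_E$ is a finite sum of elements of $[0,u_E]$, and every map $\phi:E\to K$ to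 an abelian group $K$ with $\phi(a\oplus b)=\phi(a)+\phi(b)$ whenever $a\oplus b$ is defined extends uniquely (along $\iota_E$) to a group homomorphism $G_E\to K$. A \emph{bimorphism} $\beta:E\times F\to L$ of effect algebras is a map with $\beta(1,1)=1$ that preserves $\oplus$ in each variable separately. The \emph{tensor product} of $E$ and $F$ is an effect algebra $E\otimes F$ with a bimorphism $(a,b)\mapsto a\otimes b$ from $E\times F$ through which every bimorphism from $E\times F$ to an effect algebra $L$ factors by a unique morphism $E\otimes F\to L$. The tensor product $G\otimes H$ of partially ordered abelian groups is the tensor product over $\mathbb Z$, with the positive cone generated by the elements $g\otimes h$, $g\ge0$, $h\ge0$. \medskip \textbf{Theorem.} Let $E$ and $F$ be dimension effect algebras, and let $(G_E,u_E)$ and $(G_F,u_F)$ be universal groups of $E$ and $F$, with identifications $\iota_E:E\to[0,u_E]$ and $\iota_F:F\to[0,u_F]$. Then the interval $[0,u_E\otimes u_F]$ in $G_E\otimes G_F$, with the bimorphism $(a,b)\mapsto\iota_E(a)\otimes\iota_F(b)$, is the tensor product of $E$ and $F$ in the category of effect algebras. Thus there is an isomorphism $$E\otimes F\;\simeq\;[0,u_E\otimes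 u_F]\subseteq G_E\otimes G_F$$ which maps $a\otimes b$ to $\iota_E(a)\otimes\iota_F(b)$ for all $a\in E$, $b\in F$. In particular, $E\otimes F$ is a dimension effect algebra. -/

import Mathlib

open scoped TensorProduct

universe u v

/-- An effect algebra: constants `0`, `1` and a partial binary operation `⊕`, encoded by its graph:
`IsSum a b c` says that `a ⊕ b` is defined and equal to `c`. The case `0 = 1` is allowed. -/
class EffectAlgebra (E : Type u) extends Zero E, One E where
  IsSum : E → E → E → Prop
  isSum_unique : ∀ {a b c c' : E}, IsSum a b c → IsSum a b c' → c = c'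
  isSum_comm : ∀ {a b c : E}, IsSum a b c → IsSum b a c
  isSum_assoc : ∀ {a b c d e : E}, IsSum a b d → IsSum d c e → ∃ f, IsSum b c f ∧ IsSum a f e
  existsUnique_compl : ∀ a : E, ∃! a' : E, IsSum a a' 1
  eq_zero_of_isSum_one : ∀ {a c : E}, IsSum a 1 c → a = 0

namespace EffectAlgebra

/-- The order of an effect algebra: `a ≤ b` if `a ⊕ c = b` for some `c`. -/
def Le {E : Type u} [EffectAlgebra E] (a b : E) : Prop := ∃ c, IsSum a c b

/-- Morphisms of effect algebras: `φ 1 = 1`, and if `a ⊕ b` is defined then so is `φ a ⊕ φ b`,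
and it equals `φ (a ⊕ b)`. -/
@[ext]
structure Hom (E : Type u) (F : Type v) [EffectAlgebra E] [EffectAlgebra F] where
  toFun : E → F
  map_one : toFun 1 = 1
  map_isSum : ∀ {a b c : E}, IsSum a b c → IsSum (toFun a) (toFun b) (toFun c)

instance {E : Type u} {F : Type v} [EffectAlgebra E] [EffectAlgebra F] :
    CoeFun (Hom E F) fun _ => E → F := ⟨Hom.toFun⟩

/-- Isomorphisms of effect algebras. -/
structure Iso (E : Type u) (F : Type v) [EffectAlgebra E] [EffectAlgebra F] extends E ≃ F where
  map_one : toFun 1 = 1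
  isSum_iff : ∀ a b c : E, IsSum (toFun a) (toFun b) (toFun c) ↔ IsSum a b c

instance {E : Type u} {F : Type v} [EffectAlgebra E] [EffectAlgebra F] :
    CoeFun (Iso E F) fun _ => E → F := ⟨fun φ => φ.toFun⟩

/-! ### Simplicial effect algebras, direct limits, dimension effect algebras -/

/-- The Riesz decomposition property: if `a ≤ b₁ ⊕ b₂`, then `a = a₁ ⊕ a₂` with `a₁ ≤ b₁` and
`a₂ ≤ b₂`. -/
def RieszDecomposition (E : Type u) [EffectAlgebra E] : Prop :=
  ∀ a b b₁ b₂ : E, IsSum b₁ b₂ b → Le a b → ∃ a₁ a₂, Le a₁ b₁ ∧ Le a₂ b₂ ∧ IsSum a₁ a₂ a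

/-- Simplicial effect algebras: the finite ones with the Riesz decomposition property. -/
def IsSimplicial (E : Type u) [EffectAlgebra E] : Prop :=
  Finite E ∧ RieszDecomposition E

/-- A system of effect algebras and morphisms indexed by a preordered set. -/
structure System (I : Type u) [Preorder I] where
  obj : I → Type u
  [inst : ∀ i, EffectAlgebra (obj i)]
  map : ∀ {j i : I}, j ≤ i → Hom (obj j) (obj i)
  map_id : ∀ (i : I) (a : obj i), map (le_refl i) a = a
  map_comp : ∀ {m j i : I} (hmj : m ≤ j) (hji : j ≤ i) (a : obj m),
    map hji (map hmj a) = map (hmj.trans hji) a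

attribute [instance] System.inst

/-- A family of morphisms `f i : A i → B` with `f i ∘ f_ij = f j` for `j ≤ i`. -/
def System.Compatible {I : Type u} [Preorder I] (A : System I) {B : Type u} [EffectAlgebra B]
    (f : ∀ i, Hom (A.obj i) B) : Prop :=
  ∀ {j i : I} (hji : j ≤ i) (a : A.obj j), f i (A.map hji a) = f j a

/-- `(L; f i)` is the direct limit of the system `A`. -/
def System.IsDirectLimit {I : Type u} [Preorder I] (A : System I) {L : Type u} [EffectAlgebra L]
    (f : ∀ i, Hom (A.obj i) L) : Prop :=
  A.Compatible f ∧
    ∀ (B : Type u) [EffectAlgebra B] (g : ∀ i, Hom (A.obj i) B), A.Compatible g →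
      ∃! h : Hom L B, ∀ i (a : A.obj i), h (f i a) = g i a

/-- Dimension effect algebras: direct limits of directed systems of simplicial effect algebras. -/
def IsDimension (E : Type u) [EffectAlgebra E] : Prop :=
  ∃ (I : Type u) (_ : Preorder I) (_ : Nonempty I) (_ : IsDirectedOrder I) (A : System I)
    (f : ∀ i, Hom (A.obj i) E), (∀ i, IsSimplicial (A.obj i)) ∧ A.IsDirectLimit f

/-! ### Tensor products of effect algebras -/

/-- Bimorphisms `E × F → L`. -/
structure IsBimorphism {E F L : Type u} [EffectAlgebra E] [EffectAlgebra F] [EffectAlgebra L]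
    (β : E → F → L) : Prop where
  left : ∀ {a b c : E} (q : F), IsSum a b c → IsSum (β a q) (β b q) (β c q)
  right : ∀ {a b c : F} (p : E), IsSum a b c → IsSum (β p a) (β p b) (β p c)
  map_one : β 1 1 = 1

/-- `(T, τ)` is the tensor product of `E` and `F` in the category of all effect algebras:
`τ` is a universal bimorphism. -/
def IsTensor {E F T : Type u} [EffectAlgebra E] [EffectAlgebra F] [EffectAlgebra T]
    (τ : E → F → T) : Prop :=
  IsBimorphism τ ∧
    ∀ (L : Type u) [EffectAlgebra L] (β : E → F → L), IsBimorphism β →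
      ∃! φ : Hom T L, ∀ a b, φ (τ a b) = β a b

/-! ### Unit intervals and universal groups -/

section
variable {G : Type u} [AddCommGroup G] [PartialOrder G] [IsOrderedAddMonoid G]

/-- The interval `[0, u]` in a partially ordered abelian group, where `0 ≤ u`. -/
def Interval (u : {g : G // 0 ≤ g}) : Type u := {x : G // 0 ≤ x ∧ x ≤ u.1}

/-- `[0, u]` as an effect algebra: `x ⊕ y` is defined if and only if `x + y ≤ u`, and then it is
`x + y`. -/
instance Interval.effectAlgebra (u : {g : G // 0 ≤ g}) : EffectAlgebra (Interval u) where
  zero := ⟨0, le_refl 0, u.2⟩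
  one := ⟨u.1, u.2, le_refl u.1⟩
  IsSum x y z := x.1 + y.1 = z.1
  isSum_unique h h' := Subtype.ext (h.symm.trans h')
  isSum_comm h := (add_comm _ _).trans h
  isSum_assoc {a b c d e} h h' := by
    have he : a.1 + (b.1 + c.1) = e.1 := by rw [← add_assoc, h, h']
    exact ⟨⟨b.1 + c.1, add_nonneg b.2.1 c.2.1,
      (le_add_of_nonneg_left a.2.1).trans (he.le.trans e.2.2)⟩, rfl, he⟩
  existsUnique_compl a :=
    ⟨⟨u.1 - a.1, sub_nonneg.2 a.2.2, sub_le_self _ a.2.1⟩, add_sub_cancel _ _,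
      fun _ h => Subtype.ext (eq_sub_of_add_eq' h)⟩
  eq_zero_of_isSum_one {a c} h := by
    have h' : a.1 + u.1 = c.1 := h
    refine Subtype.ext (le_antisymm ?_ a.2.1)
    have h'' : a.1 + u.1 ≤ u.1 := h'.le.trans c.2.2
    exact le_of_add_le_add_right (h''.trans_eq (zero_add u.1).symm)

/-- `φ : E → K` is a `K`-valued measure: `φ (a ⊕ b) = φ a + φ b` whenever `a ⊕ b` is defined. -/
def IsMeasure {E : Type u} [EffectAlgebra E] {K : Type u} [AddCommGroup K] (φ : E → K) : Prop :=
  ∀ {a b c : E}, IsSum a b c → φ c = φ a + φ b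

/-- `(G, u)`, with the identification `ι` of `E` with `[0, u]`, is the universal group of `E`:
`G` is directed, `u` is a generating unit, and every measure on `E` with values in an abelian
group extends uniquely to a group homomorphism on `G`. -/
structure IsUniversalGroup {E : Type u} [EffectAlgebra E] {u : {g : G // 0 ≤ g}}
    (ι : Iso E (Interval u)) : Prop where
  directed : ∀ g : G, ∃ a b : G, 0 ≤ a ∧ 0 ≤ b ∧ g = a - b
  generating : ∀ g : G, 0 ≤ g → g ∈ AddSubmonoid.closure {x : G | 0 ≤ x ∧ x ≤ u.1}
  extend : ∀ (K : Type u) [AddCommGroup K] (φ : E → K), IsMeasure φ →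
    ∃! ψ : G →+ K, ∀ a : E, ψ (ι a).1 = φ a

end

end EffectAlgebra

/-! ### Tensor products of partially ordered abelian groups

The positive cone of `G ⊗ H` is generated by the simple tensors of positive elements. To see that
it defines a partial order one needs that it is pointed, which follows from the existence of
`ℚ`-valued homomorphisms that are positive on given finitely many positive elements. -/

namespace POGroup

theorem exists_hom_pos_of_pointed {G : Type*} [AddCommGroup G] (l : List G)
    (hl : ∀ x ∈ l, -x ∉ AddSubmonoid.closure {y | y ∈ l}) :
    ∃ f : G →+ ℚ, ∀ x ∈ l, 0 < f x := by
  induction hn : l.length generalizing G with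
  | zero =>
    obtain rfl := List.length_eq_zero_iff.1 hn
    exact ⟨0, by simp⟩
  | succ n ih =>
    obtain ⟨x, l, rfl⟩ := List.exists_cons_of_length_eq_add_one hn
    have hmono : AddSubmonoid.closure {y | y ∈ l} ≤ AddSubmonoid.closure {y | y ∈ x :: l} :=
      AddSubmonoid.closure_mono fun y hy => List.mem_cons_of_mem _ hy
    have hx : x ∈ AddSubmonoid.closure {y | y ∈ x :: l} :=
      AddSubmonoid.subset_closure List.mem_cons_self
    have hlen : l.length = n := by simpa using hn
    obtain ⟨f, hf⟩ := ih l (fun y hy h => hl y (List.mem_cons_of_mem _ hy) (hmono h)) hlen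
    let q := QuotientAddGroup.mk' (AddSubgroup.zmultiples x)
    by_cases hq : ∀ y ∈ l.map q, -y ∉ AddSubmonoid.closure {z | z ∈ l.map q}
    · obtain ⟨g, hg⟩ := ih (l.map q) hq (by simpa using hlen)
      have hinj : Function.Injective (LinearMap.toSpanSingleton ℤ G x) := by
        have key : ∀ k : ℕ, k • x = 0 → k = 0 := by
          intro k hk
          cases k with
          | zero => rfl
          | succ k =>
            refine absurd ?_ (hl x List.mem_cons_self)
            have : -x = k • x := by
              rw [succ_nsmul] at hk
              exact (eq_neg_of_add_eq_zero_left hk).symm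
            rw [this]
            exact AddSubmonoid.nsmul_mem _ hx k
        rw [injective_iff_map_eq_zero]
        intro k hk
        rw [LinearMap.toSpanSingleton_apply] at hk
        obtain ⟨m, rfl | rfl⟩ := Int.eq_nat_or_neg k
        · simpa using key m (by simpa using hk)
        · simpa using key m (by simpa using hk)
      obtain ⟨h, hh⟩ := (Module.Baer.of_divisible ℚ).extension_property
        (LinearMap.toSpanSingleton ℤ G x) hinj (LinearMap.toSpanSingleton ℤ ℚ 1)
      have hx1 : h x = 1 := by simpa using LinearMap.congr_fun hh 1
      have : ∃ N : ℕ, ∀ y ∈ l, 0 < h y + N * g (q y) := by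
        clear ih hl hmono hx hn hlen hf hq hh
        induction l with
        | nil => exact ⟨0, by simp⟩
        | cons z l ihl =>
          obtain ⟨N, hN⟩ := ihl fun y hy => hg y (by
            simp only [List.map_cons, List.mem_cons]; exact Or.inr hy)
          have hz := hg (q z) (by simp)
          obtain ⟨M, hM⟩ := exists_nat_gt (-(h z) / g (q z))
          rw [div_lt_iff₀ hz] at hM
          refine ⟨N + M, fun y hy => ?_⟩
          have hy0 : 0 < g (q y) := hg _ (List.mem_map_of_mem hy)
          push_cast
          rcases List.mem_cons.1 hy with rfl | hy'
          · have := mul_nonneg (Nat.cast_nonneg (α := ℚ) N) hy0.le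
            nlinarith
          · have := mul_nonneg (Nat.cast_nonneg (α := ℚ) M) hy0.le
            have := hN y hy'
            nlinarith
      obtain ⟨N, hN⟩ := this
      refine ⟨h.toAddMonoidHom + N • g.comp q, fun y hy => ?_⟩
      rcases List.mem_cons.1 hy with rfl | hy
      · have : q y = 0 := (QuotientAddGroup.eq_zero_iff y).2 (AddSubgroup.mem_zmultiples y)
        simp [this, hx1]
      · simpa using hN y hy
    · push Not at hq
      obtain ⟨y', hy', hc⟩ := hq
      obtain ⟨y, hy, rfl⟩ := List.mem_map.1 hy'
      have himg : {z | z ∈ l.map q} = q '' {z | z ∈ l} := by ext; simp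
      rw [himg, ← AddMonoidHom.map_mclosure] at hc
      obtain ⟨s, hs, hsy⟩ := hc
      have hmem : s + y ∈ AddSubgroup.zmultiples x := by
        rw [← QuotientAddGroup.eq_zero_iff]
        change q (s + y) = 0
        rw [map_add, hsy, neg_add_cancel]
      obtain ⟨k, hk⟩ := AddSubgroup.mem_zmultiples_iff.1 hmem
      have hfs : 0 ≤ f s := by
        have : AddSubmonoid.closure {y | y ∈ l} ≤ (AddSubmonoid.nonneg ℚ).comap f := by
          rw [AddSubmonoid.closure_le]
          exact fun z hz => (hf z hz).le
        exact this hs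
      have hfk : 0 < (k : ℚ) * f x := by
        have := congrArg f hk
        rw [map_zsmul, map_add, zsmul_eq_mul] at this
        rw [this]
        exact add_pos_of_nonneg_of_pos hfs (hf y hy)
      have hkpos : 0 < k := by
        by_contra hk0
        obtain ⟨m, hm⟩ := Int.exists_eq_neg_ofNat (not_lt.1 hk0)
        refine hl y (List.mem_cons_of_mem _ hy) ?_
        have : -y = s + m • x := by
          rw [hm, neg_zsmul, natCast_zsmul] at hk
          rw [neg_eq_iff_add_eq_zero, add_comm, add_right_comm, ← hk, neg_add_cancel]
        rw [this]
        exact add_mem (hmono hs) (AddSubmonoid.nsmul_mem _ hx m)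
      refine ⟨f, fun z hz => ?_⟩
      rcases List.mem_cons.1 hz with rfl | hz
      · exact (pos_iff_pos_of_mul_pos hfk).1 (by exact_mod_cast hkpos)
      · exact hf z hz

theorem exists_hom_pos {G : Type*} [AddCommGroup G] [PartialOrder G] [IsOrderedAddMonoid G]
    (l : List G) (hl : ∀ x ∈ l, 0 < x) : ∃ f : G →+ ℚ, ∀ x ∈ l, 0 < f x := by
  refine exists_hom_pos_of_pointed l fun x hx hc => ?_
  have : AddSubmonoid.closure {y | y ∈ l} ≤ AddSubmonoid.nonneg G := by
    rw [AddSubmonoid.closure_le]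
    exact fun z hz => (hl z hz).le
  have h : 0 ≤ -x := this hc
  exact absurd (hl x hx) (not_lt_of_ge (by simpa using h))

section
variable (G H : Type*) [AddCommGroup G] [PartialOrder G] [IsOrderedAddMonoid G]
  [AddCommGroup H] [PartialOrder H] [IsOrderedAddMonoid H]

/-- The submonoid of `G ⊗ H` generated by the simple tensors of positive elements. -/
def tensorCone : AddSubmonoid (G ⊗[ℤ] H) :=
  AddSubmonoid.closure {x | ∃ a : G, ∃ b : H, 0 ≤ a ∧ 0 ≤ b ∧ x = a ⊗ₜ[ℤ] b}

theorem eq_zero_of_sum_eq_zero (l : List (G ⊗[ℤ] H))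
    (hl : ∀ x ∈ l, ∃ a : G, ∃ b : H, 0 ≤ a ∧ 0 ≤ b ∧ x = a ⊗ₜ[ℤ] b)
    (hs : l.sum = 0) : ∀ x ∈ l, x = 0 := by
  classical
  choose! a b ha hb hab using hl
  let m := l.filter fun x => decide (x ≠ 0)
  have hm : ∀ x ∈ m, x ∈ l ∧ x ≠ 0 := fun x hx => by simpa [m] using hx
  obtain ⟨f, hf⟩ := exists_hom_pos (m.map a) (by
    intro y hy
    obtain ⟨x, hx, rfl⟩ := List.mem_map.1 hy
    refine (ha x (hm x hx).1).lt_of_ne fun h => (hm x hx).2 ?_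
    rw [hab x (hm x hx).1, ← h, TensorProduct.zero_tmul])
  obtain ⟨g, hg⟩ := exists_hom_pos (m.map b) (by
    intro y hy
    obtain ⟨x, hx, rfl⟩ := List.mem_map.1 hy
    refine (hb x (hm x hx).1).lt_of_ne fun h => (hm x hx).2 ?_
    rw [hab x (hm x hx).1, ← h, TensorProduct.tmul_zero])
  let F : G ⊗[ℤ] H →ₗ[ℤ] ℚ :=
    LinearMap.mul' ℤ ℚ ∘ₗ TensorProduct.map f.toIntLinearMap g.toIntLinearMap
  have hpos : ∀ x ∈ l, x ≠ 0 → 0 < F x := by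
    intro x hx hx0
    have hxm : x ∈ m := by simp [m, hx, hx0]
    rw [hab x hx]
    exact mul_pos (hf _ (List.mem_map_of_mem hxm)) (hg _ (List.mem_map_of_mem hxm))
  have hnn : ∀ y ∈ l.map F, 0 ≤ y := by
    intro y hy
    obtain ⟨x, hx, rfl⟩ := List.mem_map.1 hy
    by_cases h : x = 0
    · simp [h]
    · exact (hpos x hx h).le
  have hsum : (l.map F).sum = 0 := by rw [← map_list_sum, hs, map_zero]
  intro x hx
  by_contra hx0
  have h1 := List.single_le_sum hnn (F x) (List.mem_map_of_mem hx)
  have h2 := hpos x hx hx0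
  rw [hsum] at h1
  exact absurd h2 (not_lt_of_ge h1)

theorem tensorCone_pointed {x : G ⊗[ℤ] H} (hx : x ∈ tensorCone G H)
    (hx' : -x ∈ tensorCone G H) : x = 0 := by
  obtain ⟨l, hl, rfl⟩ := AddSubmonoid.exists_list_of_mem_closure hx
  obtain ⟨l', hl', hs⟩ := AddSubmonoid.exists_list_of_mem_closure hx'
  have h := eq_zero_of_sum_eq_zero G H (l ++ l')
    (fun y hy => (List.mem_append.1 hy).elim (hl y) (hl' y)) (by rw [List.sum_append, hs, add_neg_cancel])
  exact List.sum_eq_zero fun y hy => h y (List.mem_append_left _ hy)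

/-- The partial order of `G ⊗ H` whose positive cone is `tensorCone G H`. -/
instance tensorPartialOrder : PartialOrder (G ⊗[ℤ] H) where
  le x y := y - x ∈ tensorCone G H
  le_refl x := by rw [sub_self]; exact zero_mem _
  le_trans x y z hxy hyz := by rw [← sub_add_sub_cancel z y x]; exact add_mem hyz hxy
  le_antisymm x y hxy hyx :=
    (sub_eq_zero.1 (tensorCone_pointed G H hxy (by rw [neg_sub]; exact hyx))).symm

instance tensorIsOrderedAddMonoid : IsOrderedAddMonoid (G ⊗[ℤ] H) where
  add_le_add_left x y hxy c := by
    change y + c - (x + c) ∈ tensorCone G H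
    rw [add_sub_add_right_eq_sub]
    exact hxy

end

/-- The element `u ⊗ v` of `G ⊗ H`, for positive `u` and `v`. -/
def tensorUnit {G H : Type*} [AddCommGroup G] [PartialOrder G] [IsOrderedAddMonoid G]
    [AddCommGroup H] [PartialOrder H] [IsOrderedAddMonoid H]
    (u : {g : G // 0 ≤ g}) (v : {h : H // 0 ≤ h}) : {x : G ⊗[ℤ] H // 0 ≤ x} :=
  ⟨u.1 ⊗ₜ[ℤ] v.1, by
    change u.1 ⊗ₜ[ℤ] v.1 - 0 ∈ tensorCone G H
    rw [sub_zero]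
    exact AddSubmonoid.subset_closure ⟨u.1, v.1, u.2, v.2, rfl⟩⟩

end POGroup

/-!
Totalize an effect algebra by one extra element that stands for the value of an undefined sum: it
becomes a commutative monoid (`Total`), and iterated partial sums become ordinary sums. A finite
effect algebra with the Riesz decomposition property is then an interval `[0, u]` in a group `ℤⁿ`
with coordinatewise order, since every element is a sum of atoms in exactly one way
(`IsSimplicial.exists_iso`). Additive maps on such an interval are determined by their values on
the basis. For intervals `[0, u] ⊆ ℤᵐ` and `[0, v] ⊆ ℤⁿ` this gives the theorem at once: a
bimorphism `β` factors through `[0, u ⊗ v] ⊆ ℤᵐⁿ` by `x ↦ ∑ xₖₗ β(eₖ, eₗ)`, and the sum is defined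
because it is dominated by the sum for `x = u ⊗ v`, which is `β(1, 1) = 1`
(`SimplicialBasis.isTensor_tmul`).

The general case follows by passage to the limit. A directed limit of effect algebras is the
quotient of the disjoint union of the stages, so that elements come from the stages and every sum
is already defined at some stage (`System.IsDirectLimit.isExplicitLimit`). Hence a measure on a
dimension effect algebra is a compatible family of homomorphisms on the groups `ℤⁿ` of the stages,
and the universal group is the limit of these groups as an ordered group
(`IsUniversalGroup.exists_presentation`). Tensor products commute with this limit: positive elements
of `G ⊗ H` come from positive elements of the stages `Uᵢ ⊗ Vⱼ`, and elements that vanish in `G ⊗ H`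
vanish at some stage (`POGroup.exists_tensorMap_eq_zero`). Therefore `[0, u ⊗ v]` is the directed
limit of the intervals `[0, uᵢ ⊗ vⱼ]` (`SimplicialPresentation.isExplicitLimit_tensorHom`), which
are simplicial and are the tensor products of the stages, and the universal property passes to the
limit (`SimplicialPresentation.isTensor_tmul`).
-/

namespace EffectAlgebra

/-! ### Effect algebras and partial sums -/

section Basic
variable {E : Type u} [EffectAlgebra E]

theorem isSum_zero (a : E) : IsSum a 0 a := by
  have h1 : IsSum (1 : E) 0 1 := by
    obtain ⟨z, hz, -⟩ := existsUnique_compl (1 : E)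
    obtain rfl := eq_zero_of_isSum_one (isSum_comm hz)
    exact hz
  obtain ⟨a', ha', -⟩ := existsUnique_compl a
  obtain ⟨f, hf, hf'⟩ := isSum_assoc (isSum_comm ha') h1
  rwa [(existsUnique_compl a').unique hf' (isSum_comm ha')] at hf

theorem isSum_zero_left (a : E) : IsSum 0 a a := isSum_comm (isSum_zero a)

theorem isSum_left_cancel {a b c d : E} (hb : IsSum a b d) (hc : IsSum a c d) : b = c := by
  obtain ⟨e, he, -⟩ := existsUnique_compl d
  obtain ⟨f, hf, hf'⟩ := isSum_assoc hb he
  obtain ⟨g, hg, hg'⟩ := isSum_assoc hc he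
  obtain rfl := (existsUnique_compl a).unique hf' hg'
  obtain ⟨s, hs, hs'⟩ := isSum_assoc hf (isSum_comm hf')
  obtain ⟨t, ht, ht'⟩ := isSum_assoc hg (isSum_comm hf')
  obtain rfl := isSum_unique hs ht
  exact (existsUnique_compl s).unique (isSum_comm hs') (isSum_comm ht')

theorem eq_of_isSum_zero {a b : E} (h : IsSum a 0 b) : a = b := isSum_unique (isSum_zero a) h

theorem eq_zero_of_isSum_zero {a b : E} (h : IsSum a b 0) : a = 0 := by
  obtain ⟨f, hf, -⟩ := isSum_assoc (isSum_comm h) (isSum_zero_left 1)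
  exact eq_zero_of_isSum_one hf

theorem eq_zero_of_isSum_self {a b : E} (h : IsSum a b a) : b = 0 :=
  isSum_left_cancel h (isSum_zero a)

theorem map_zero_of_map_isSum {F : Type v} [EffectAlgebra F] {f : E → F}
    (hf : ∀ {a b c : E}, IsSum a b c → IsSum (f a) (f b) (f c)) : f 0 = 0 :=
  eq_zero_of_isSum_self (hf (isSum_zero 0))

end Basic

/-- The elements of an effect algebra together with one further element, which stands for the
value of an undefined sum. With it the partial operation becomes a total one, so that iterated
sums in an effect algebra can be written as sums in a commutative monoid. -/
inductive Total (E : Type u) : Type u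
  | of (a : E) : Total E
  | undefined : Total E

namespace Total
variable {E : Type u}

theorem of_injective : Function.Injective (of : E → Total E) := fun _ _ => of.inj

theorem ext_of {x y : Total E} (h : ∀ c, x = of c ↔ y = of c) : x = y := by
  cases x with
  | of a => exact ((h a).1 rfl).symm
  | undefined =>
    cases y with
    | of a => exact (h a).2 rfl
    | undefined => rfl

variable [EffectAlgebra E]

open Classical in
noncomputable instance : Add (Total E) where
  add x y := if h : ∃ c, ∃ a b, x = of a ∧ y = of b ∧ IsSum a b c then of h.choose else undefined

theorem add_eq_of_iff {x y : Total E} {c : E} :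
    x + y = of c ↔ ∃ a b, x = of a ∧ y = of b ∧ IsSum a b c := by
  classical
  change (if h : ∃ c, ∃ a b, x = of a ∧ y = of b ∧ IsSum a b c then of h.choose else undefined)
    = of c ↔ _
  constructor
  · intro h
    split_ifs at h with h'
    · rw [← of_injective h]
      exact h'.choose_spec
  · rintro ⟨a, b, rfl, rfl, h⟩
    have h' : ∃ c, ∃ a' b', of a = of a' ∧ of b = of b' ∧ IsSum a' b' c := ⟨c, a, b, rfl, rfl, h⟩
    refine (dif_pos h').trans ?_
    obtain ⟨a', b', ha, hb, hs⟩ := h'.choose_spec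
    rw [← of_injective ha, ← of_injective hb] at hs
    rw [isSum_unique hs h]

theorem of_add_of {a b c : E} : of a + of b = of c ↔ IsSum a b c := by
  rw [add_eq_of_iff]
  constructor
  · rintro ⟨a', b', ha, hb, h⟩
    rwa [of_injective ha, of_injective hb]
  · exact fun h => ⟨a, b, rfl, rfl, h⟩

protected theorem add_comm (x y : Total E) : x + y = y + x := by
  refine ext_of fun c => ?_
  simp only [add_eq_of_iff]
  constructor <;> exact fun ⟨a, b, ha, hb, h⟩ => ⟨b, a, hb, ha, isSum_comm h⟩

noncomputable instance : Zero (Total E) := ⟨of 0⟩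

noncomputable instance : AddCommMonoid (Total E) where
  add_comm := Total.add_comm
  zero_add x := by
    refine ext_of fun c => ?_
    change of 0 + x = of c ↔ _
    rw [add_eq_of_iff]
    constructor
    · rintro ⟨a, b, ha, rfl, h⟩
      rw [← of_injective ha] at h
      rw [isSum_unique (isSum_zero_left b) h]
    · rintro rfl
      exact ⟨0, c, rfl, rfl, isSum_zero_left c⟩
  add_zero x := by
    refine ext_of fun c => ?_
    change x + of 0 = of c ↔ _
    rw [add_eq_of_iff]
    constructor
    · rintro ⟨a, b, rfl, hb, h⟩
      rw [← of_injective hb] at h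
      rw [isSum_unique (isSum_zero a) h]
    · rintro rfl
      exact ⟨c, 0, rfl, rfl, isSum_zero c⟩
  add_assoc x y z := by
    have key : ∀ {x y z : Total E} {e : E}, x + y + z = of e → x + (y + z) = of e := by
      intro x y z e h
      obtain ⟨d, c, hd, rfl, h1⟩ := add_eq_of_iff.1 h
      obtain ⟨a, b, rfl, rfl, h2⟩ := add_eq_of_iff.1 hd
      obtain ⟨f, hf, hf'⟩ := isSum_assoc h2 h1
      rw [of_add_of.2 hf, of_add_of.2 hf']
    refine ext_of fun c => ⟨key, fun h => ?_⟩
    rw [Total.add_comm x, Total.add_comm y] at h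
    rw [Total.add_comm, Total.add_comm x]
    exact key h
  nsmul := nsmulRec

theorem of_zero : of (0 : E) = 0 := rfl

theorem exists_of_add_eq_of {x y : Total E} {c : E} (h : x + y = of c) : ∃ a, x = of a := by
  obtain ⟨a, b, rfl, -, -⟩ := add_eq_of_iff.1 h
  exact ⟨a, rfl⟩

end Total

/-- A map from an effect algebra to a commutative monoid which preserves `0` and all sums that are
defined. -/
structure IsAdditive {E : Type u} [EffectAlgebra E] {M : Type v} [AddCommMonoid M]
    (γ : E → M) : Prop where
  map_zero : γ 0 = 0
  map_isSum : ∀ {a b c : E}, IsSum a b c → γ c = γ a + γ b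

theorem isAdditive_of {E : Type u} {L : Type v} [EffectAlgebra E] [EffectAlgebra L] {f : E → L}
    (hf : ∀ {a b c : E}, IsSum a b c → IsSum (f a) (f b) (f c)) :
    IsAdditive fun a => Total.of (f a) where
  map_zero := by rw [map_zero_of_map_isSum hf, Total.of_zero]
  map_isSum h := (Total.of_add_of.2 (hf h)).symm

/-- An additive map to a totalization which sends `1` to `1` takes no undefined value, since
`γ a + γ a' = 1` for the complement `a'` of `a`. -/
theorem IsAdditive.exists_hom {E : Type u} {L : Type v} [EffectAlgebra E] [EffectAlgebra L]
    {γ : E → Total L} (hγ : IsAdditive γ) (h1 : γ 1 = Total.of 1) :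
    ∃ φ : Hom E L, ∀ a, Total.of (φ a) = γ a := by
  have key : ∀ a, ∃ x, γ a = Total.of x := by
    intro a
    obtain ⟨a', ha', -⟩ := existsUnique_compl a
    exact Total.exists_of_add_eq_of ((hγ.map_isSum ha').symm.trans h1)
  choose φ hφ using key
  refine ⟨⟨φ, Total.of_injective ((hφ 1).symm.trans h1), fun {a b c} h => ?_⟩,
    fun a => (hφ a).symm⟩
  rw [← Total.of_add_of, ← hφ, ← hφ, ← hφ]
  exact (hγ.map_isSum h).symm

/-! ### Morphisms and isomorphisms -/

section Maps
variable {A : Type u} {B : Type v} [EffectAlgebra A] [EffectAlgebra B]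

theorem Hom.map_zero (f : Hom A B) : f 0 = 0 := map_zero_of_map_isSum f.map_isSum

theorem Hom.ext' {f g : Hom A B} (h : ∀ a, f a = g a) : f = g := Hom.ext (funext h)

/-- The identity morphism. -/
def Hom.id (A : Type u) [EffectAlgebra A] : Hom A A := ⟨fun a => a, rfl, fun h => h⟩

/-- The composition of two morphisms. -/
def Hom.comp {C : Type*} [EffectAlgebra C] (g : Hom B C) (f : Hom A B) : Hom A C :=
  ⟨fun a => g (f a), (congrArg g.toFun f.map_one).trans g.map_one,
    fun h => g.map_isSum (f.map_isSum h)⟩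

/-- The inverse of an isomorphism. -/
def Iso.symm (e : Iso A B) : Iso B A where
  toEquiv := e.toEquiv.symm
  map_one := e.toEquiv.symm_apply_eq.2 e.map_one.symm
  isSum_iff a b c := by
    rw [← e.isSum_iff]
    simp

/-- The morphism underlying an isomorphism. -/
def Iso.toHom (e : Iso A B) : Hom A B := ⟨e.toFun, e.map_one, (e.isSum_iff _ _ _).2⟩

theorem Iso.symm_apply_apply (e : Iso A B) (a : A) : e.symm (e a) = a :=
  e.toEquiv.symm_apply_apply a

theorem Iso.apply_symm_apply (e : Iso A B) (b : B) : e (e.symm b) = b :=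
  e.toEquiv.apply_symm_apply b

/-- Two morphisms that are inverse to each other form an isomorphism. -/
def Iso.ofHom (f : Hom A B) (g : Hom B A) (hgf : ∀ a, g (f a) = a) (hfg : ∀ b, f (g b) = b) :
    Iso A B where
  toFun := f
  invFun := g
  left_inv := hgf
  right_inv := hfg
  map_one := f.map_one
  isSum_iff a b c := by
    refine ⟨fun h => ?_, f.map_isSum⟩
    have := g.map_isSum h
    rwa [hgf, hgf, hgf] at this

end Maps

theorem IsDimension.of_iso {A B : Type u} [EffectAlgebra A] [EffectAlgebra B] (e : Iso A B)
    (hA : IsDimension A) : IsDimension B := by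
  obtain ⟨I, _, hI, hd, S, f, hS, hc, hu⟩ := hA
  refine ⟨I, _, hI, hd, S, fun i => e.toHom.comp (f i), hS,
    fun hji a => congrArg e (hc hji a), fun C _ g hg => ?_⟩
  obtain ⟨h, hh, hh'⟩ := hu C g hg
  refine ⟨h.comp e.symm.toHom, fun i a => ?_, fun h₂ hh₂ => ?_⟩
  · exact (congrArg h (e.symm_apply_apply _)).trans (hh i a)
  · have h₃ := hh' (h₂.comp e.toHom) hh₂
    refine Hom.ext' fun b => ?_
    subst h₃
    exact (congrArg h₂ (e.apply_symm_apply b)).symm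

/-- Two tensor products of the same effect algebras are isomorphic. -/
theorem IsTensor.exists_iso {E F T T' : Type u} [EffectAlgebra E] [EffectAlgebra F]
    [EffectAlgebra T] [EffectAlgebra T'] {t : E → F → T} {t' : E → F → T'} (h : IsTensor t)
    (h' : IsTensor t') : ∃ φ : Iso T T', ∀ a b, φ (t a b) = t' a b := by
  obtain ⟨f, hf, -⟩ := h.2 T' t' h'.1
  obtain ⟨g, hg, -⟩ := h'.2 T t h.1
  have h₁ : g.comp f = Hom.id T := (h.2 T t h.1).unique
    (fun a b => (congrArg g (hf a b)).trans (hg a b)) fun _ _ => rfl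
  have h₂ : f.comp g = Hom.id T' := (h'.2 T' t' h'.1).unique
    (fun a b => (congrArg f (hg a b)).trans (hf a b)) fun _ _ => rfl
  exact ⟨Iso.ofHom f g (fun a => congrArg (fun k => Hom.toFun k a) h₁)
    fun b => congrArg (fun k => Hom.toFun k b) h₂, hf⟩

/-! ### Directed limits -/

namespace System
variable {I : Type u} [Preorder I] (A : System I) {L : Type u} [EffectAlgebra L]

/-- An elementary description of directed limits: every element of `L` comes from some stage, and
every sum in `L` of elements of one stage is already defined at some later stage. -/
structure IsExplicitLimit (f : ∀ i, Hom (A.obj i) L) : Prop where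
  compatible : A.Compatible f
  surj : ∀ x, ∃ i a, f i a = x
  isSum : ∀ {i} {a b c : A.obj i}, IsSum (f i a) (f i b) (f i c) →
    ∃ j, ∃ h : i ≤ j, IsSum (A.map h a) (A.map h b) (A.map h c)

variable {A}

namespace IsExplicitLimit
variable {f : ∀ i, Hom (A.obj i) L}

theorem exists_map_eq (hf : A.IsExplicitLimit f) {i : I} {a b : A.obj i} (h : f i a = f i b) :
    ∃ j, ∃ h : i ≤ j, A.map h a = A.map h b := by
  have h0 : IsSum (f i a) (f i 0) (f i b) := by
    rw [h, Hom.map_zero]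
    exact isSum_zero _
  obtain ⟨j, hij, hs⟩ := hf.isSum h0
  rw [Hom.map_zero] at hs
  exact ⟨j, hij, eq_of_isSum_zero hs⟩

variable [IsDirectedOrder I]

theorem exists_map_eq' (hf : A.IsExplicitLimit f) {i j : I} {a : A.obj i} {b : A.obj j}
    (h : f i a = f j b) : ∃ k, ∃ hi : i ≤ k, ∃ hj : j ≤ k, A.map hi a = A.map hj b := by
  obtain ⟨k, hi, hj⟩ := exists_ge_ge i j
  rw [← hf.compatible hi, ← hf.compatible hj] at h
  obtain ⟨l, hl, hs⟩ := hf.exists_map_eq h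
  rw [A.map_comp, A.map_comp] at hs
  exact ⟨l, _, _, hs⟩

theorem exists_common (hf : A.IsExplicitLimit f) (x y z : L) :
    ∃ i a b c, f i a = x ∧ f i b = y ∧ f i c = z := by
  obtain ⟨i, a, rfl⟩ := hf.surj x
  obtain ⟨j, b, rfl⟩ := hf.surj y
  obtain ⟨k, c, rfl⟩ := hf.surj z
  obtain ⟨l, hi, hj⟩ := exists_ge_ge i j
  obtain ⟨m, hl, hk⟩ := exists_ge_ge l k
  exact ⟨m, A.map (hi.trans hl) a, A.map (hj.trans hl) b, A.map hk c, hf.compatible _ _,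
    hf.compatible _ _, hf.compatible _ _⟩

/-- A family of maps of sets that is compatible with the transition maps factors through the
limit. -/
theorem exists_factor (hf : A.IsExplicitLimit f) {X : Type*} (g : ∀ i, A.obj i → X)
    (hg : ∀ {j i : I} (hji : j ≤ i) (a : A.obj j), g i (A.map hji a) = g j a) :
    ∃ h : L → X, ∀ i a, h (f i a) = g i a := by
  choose s r hr using hf.surj
  refine ⟨fun x => g (s x) (r x), fun i a => ?_⟩
  obtain ⟨k, hi, hj, hk⟩ := hf.exists_map_eq' (hr (f i a))
  exact (hg hi _).symm.trans ((congrArg (g k) hk).trans (hg hj _))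

theorem isDirectLimit [Nonempty I] (hf : A.IsExplicitLimit f) : A.IsDirectLimit f := by
  refine ⟨hf.compatible, fun B _ g hg => ?_⟩
  obtain ⟨h, hh⟩ := hf.exists_factor (fun i => (g i).toFun) hg
  refine ⟨⟨h, ?_, fun {x y z} hs => ?_⟩, hh, fun h' hh' => ?_⟩
  · obtain ⟨i⟩ := ‹Nonempty I›
    rw [← (f i).map_one, hh, (g i).map_one]
  · obtain ⟨i, a, b, c, rfl, rfl, rfl⟩ := hf.exists_common x y z
    obtain ⟨j, hij, hs⟩ := hf.isSum hs
    rw [hh, hh, hh, ← hg hij, ← hg hij, ← hg hij]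
    exact (g j).map_isSum hs
  · refine Hom.ext' fun x => ?_
    obtain ⟨i, a, rfl⟩ := hf.surj x
    exact (hh' i a).trans (hh i a).symm

end IsExplicitLimit

variable [IsDirectedOrder I] (A)

/-- Elements of two stages are identified in the limit if they agree at some later stage. -/
def limitSetoid : Setoid (Σ i, A.obj i) where
  r x y := ∃ k, ∃ hx : x.1 ≤ k, ∃ hy : y.1 ≤ k, A.map hx x.2 = A.map hy y.2
  iseqv :=
    { refl := fun x => ⟨x.1, le_rfl, le_rfl, rfl⟩
      symm := fun ⟨k, hx, hy, h⟩ => ⟨k, hy, hx, h.symm⟩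
      trans := fun {x y z} ⟨k, hx, hy, h⟩ ⟨l, hy', hz, h'⟩ => by
        obtain ⟨m, hk, hl⟩ := exists_ge_ge k l
        refine ⟨m, hx.trans hk, hz.trans hl, ?_⟩
        rw [← A.map_comp hx hk, h, A.map_comp, ← A.map_comp hz hl, ← h', A.map_comp] }

/-- The directed limit of the underlying sets of a directed system of effect algebras. -/
def Limit : Type u := Quotient A.limitSetoid

variable {A}

/-- The element of the limit represented by an element of one stage. -/
def Limit.of (i : I) (a : A.obj i) : A.Limit := Quotient.mk A.limitSetoid ⟨i, a⟩

theorem Limit.of_eq_of_iff {i j : I} {a : A.obj i} {b : A.obj j} :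
    Limit.of i a = Limit.of j b ↔ ∃ k, ∃ hi : i ≤ k, ∃ hj : j ≤ k, A.map hi a = A.map hj b :=
  Quotient.eq

theorem Limit.of_map {i j : I} (h : i ≤ j) (a : A.obj i) : Limit.of j (A.map h a) = Limit.of i a :=
  Limit.of_eq_of_iff.2 ⟨j, le_rfl, h, A.map_id _ _⟩

theorem Limit.exists_of (x : A.Limit) : ∃ i a, Limit.of i a = x := by
  obtain ⟨⟨i, a⟩, rfl⟩ := Quotient.exists_rep x
  exact ⟨i, a, rfl⟩

/-- The graph of the partial sum of the limit: the sum is defined at some stage. -/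
def Limit.Sum (x y z : A.Limit) : Prop :=
  ∃ i, ∃ a b c : A.obj i, IsSum a b c ∧ x = Limit.of i a ∧ y = Limit.of i b ∧ z = Limit.of i c

theorem Limit.sum_of_iff {i : I} {a b c : A.obj i} :
    Limit.Sum (Limit.of i a) (Limit.of i b) (Limit.of i c) ↔
      ∃ j, ∃ h : i ≤ j, IsSum (A.map h a) (A.map h b) (A.map h c) := by
  constructor
  · rintro ⟨j, a', b', c', hs, ha, hb, hc⟩
    obtain ⟨k₁, h₁, h₁', e₁⟩ := Limit.of_eq_of_iff.1 ha
    obtain ⟨k₂, h₂, h₂', e₂⟩ := Limit.of_eq_of_iff.1 hb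
    obtain ⟨k₃, h₃, h₃', e₃⟩ := Limit.of_eq_of_iff.1 hc
    obtain ⟨l, hl₁, hl₂⟩ := exists_ge_ge k₁ k₂
    obtain ⟨m, hl, hm₃⟩ := exists_ge_ge l k₃
    refine ⟨m, h₁.trans (hl₁.trans hl), ?_⟩
    have e₁' : A.map (h₁.trans (hl₁.trans hl)) a = A.map (h₁'.trans (hl₁.trans hl)) a' := by
      rw [← A.map_comp h₁ (hl₁.trans hl), e₁, A.map_comp]
    have e₂' : A.map (h₂.trans (hl₂.trans hl)) b = A.map (h₂'.trans (hl₂.trans hl)) b' := by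
      rw [← A.map_comp h₂ (hl₂.trans hl), e₂, A.map_comp]
    have e₃' : A.map (h₃.trans hm₃) c = A.map (h₃'.trans hm₃) c' := by
      rw [← A.map_comp h₃ hm₃, e₃, A.map_comp]
    rw [e₁', e₂', e₃']
    exact (A.map _).map_isSum hs
  · rintro ⟨j, h, hs⟩
    exact ⟨j, _, _, _, hs, (of_map _ _).symm, (of_map _ _).symm, (of_map _ _).symm⟩

theorem Limit.exists_common₂ (x y : A.Limit) : ∃ i a b, Limit.of i a = x ∧ Limit.of i b = y := by
  obtain ⟨i, a, rfl⟩ := Limit.exists_of x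
  obtain ⟨j, b, rfl⟩ := Limit.exists_of y
  obtain ⟨k, hi, hj⟩ := exists_ge_ge i j
  exact ⟨k, A.map hi a, A.map hj b, Limit.of_map _ _, Limit.of_map _ _⟩

theorem Limit.exists_common₃ (x y z : A.Limit) :
    ∃ i a b c, Limit.of i a = x ∧ Limit.of i b = y ∧ Limit.of i c = z := by
  obtain ⟨i, a, b, rfl, rfl⟩ := Limit.exists_common₂ x y
  obtain ⟨j, c, rfl⟩ := Limit.exists_of z
  obtain ⟨k, hi, hj⟩ := exists_ge_ge i j
  exact ⟨k, A.map hi a, A.map hi b, A.map hj c, Limit.of_map _ _, Limit.of_map _ _,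
    Limit.of_map _ _⟩

theorem Limit.of_eq_of_common (g : ∀ i, A.obj i) (hg : ∀ {i j : I} (h : i ≤ j), A.map h (g i) = g j)
    (i j : I) : Limit.of i (g i) = Limit.of j (g j) := by
  obtain ⟨k, hi, hj⟩ := exists_ge_ge i j
  exact Limit.of_eq_of_iff.2 ⟨k, hi, hj, (hg hi).trans (hg hj).symm⟩

variable [Nonempty I]

theorem Limit.of_zero (i : I) :
    Limit.of i (0 : A.obj i) = Limit.of (Classical.arbitrary I) (0 : A.obj _) :=
  Limit.of_eq_of_common (fun _ => 0) (fun _ => Hom.map_zero _) _ _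

theorem Limit.of_one (i : I) :
    Limit.of i (1 : A.obj i) = Limit.of (Classical.arbitrary I) (1 : A.obj _) :=
  Limit.of_eq_of_common (fun _ => 1) (fun h => (A.map h).map_one) _ _

noncomputable instance : EffectAlgebra A.Limit where
  zero := Limit.of (Classical.arbitrary I) 0
  one := Limit.of (Classical.arbitrary I) 1
  IsSum := Limit.Sum
  isSum_unique {x y z z'} h h' := by
    obtain ⟨i, a, b, c, rfl, rfl, rfl⟩ := Limit.exists_common₃ x y z
    obtain ⟨j, hij, hs⟩ := Limit.sum_of_iff.1 h
    obtain ⟨k, c', rfl⟩ := Limit.exists_of z'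
    obtain ⟨l, hj, hk⟩ := exists_ge_ge j k
    rw [← Limit.of_map (hij.trans hj) a, ← Limit.of_map (hij.trans hj) b, ← Limit.of_map hk,
      Limit.sum_of_iff] at h'
    obtain ⟨m, hm, hs'⟩ := h'
    have hs'' := (A.map hm).map_isSum ((A.map hj).map_isSum hs)
    simp only [A.map_comp] at hs'' hs'
    rw [← Limit.of_map (hij.trans (hj.trans hm)), ← Limit.of_map (hk.trans hm),
      isSum_unique hs' hs'']
  isSum_comm := fun ⟨i, a, b, c, h, ha, hb, hc⟩ => ⟨i, b, a, c, isSum_comm h, hb, ha, hc⟩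
  isSum_assoc {x y z w t} h h' := by
    obtain ⟨i, a, b, d, rfl, rfl, rfl⟩ := Limit.exists_common₃ x y w
    obtain ⟨j, hij, hs⟩ := Limit.sum_of_iff.1 h
    obtain ⟨k, c, e, rfl, rfl⟩ := Limit.exists_common₂ z t
    obtain ⟨l, hj, hk⟩ := exists_ge_ge j k
    rw [← Limit.of_map (hij.trans hj), ← Limit.of_map hk c, ← Limit.of_map hk e,
      Limit.sum_of_iff] at h'
    obtain ⟨m, hm, hs'⟩ := h'
    have hs'' := (A.map hm).map_isSum ((A.map hj).map_isSum hs)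
    simp only [A.map_comp] at hs'' hs'
    obtain ⟨f, hf, hf'⟩ := isSum_assoc hs'' hs'
    exact ⟨Limit.of m f, ⟨m, _, _, _, hf, (Limit.of_map _ _).symm, (Limit.of_map _ _).symm, rfl⟩,
      ⟨m, _, _, _, hf', (Limit.of_map _ _).symm, rfl, (Limit.of_map _ _).symm⟩⟩
  existsUnique_compl x := by
    obtain ⟨i, a, rfl⟩ := Limit.exists_of x
    obtain ⟨a', ha', -⟩ := existsUnique_compl a
    refine ⟨Limit.of i a', ⟨i, a, a', 1, ha', rfl, rfl, (Limit.of_one i).symm⟩, fun y h => ?_⟩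
    obtain ⟨j, b, rfl⟩ := Limit.exists_of y
    obtain ⟨k, hi, hj⟩ := exists_ge_ge i j
    change Limit.Sum _ _ (Limit.of (Classical.arbitrary I) 1) at h
    rw [← Limit.of_map hi, ← Limit.of_map hj, ← Limit.of_one k, Limit.sum_of_iff] at h
    obtain ⟨l, hl, hs⟩ := h
    have hs' := (A.map hl).map_isSum ((A.map hi).map_isSum ha')
    rw [(A.map hi).map_one] at hs'
    rw [← Limit.of_map hj, ← Limit.of_map hl, isSum_left_cancel hs hs', Limit.of_map,
      Limit.of_map]
  eq_zero_of_isSum_one {x z} h := by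
    obtain ⟨i, a, c, rfl, rfl⟩ := Limit.exists_common₂ x z
    change Limit.Sum _ (Limit.of (Classical.arbitrary I) 1) _ at h
    rw [← Limit.of_one i, Limit.sum_of_iff] at h
    obtain ⟨j, hij, hs⟩ := h
    rw [(A.map hij).map_one] at hs
    rw [← Limit.of_map hij, eq_zero_of_isSum_one hs]
    exact Limit.of_zero j

/-- The morphism from one stage to the limit. -/
noncomputable def Limit.hom (i : I) : Hom (A.obj i) A.Limit :=
  ⟨Limit.of i, Limit.of_one i, fun h => ⟨i, _, _, _, h, rfl, rfl, rfl⟩⟩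

theorem Limit.isExplicitLimit : A.IsExplicitLimit (Limit.hom (A := A)) where
  compatible := Limit.of_map
  surj := Limit.exists_of
  isSum := Limit.sum_of_iff.1

/-- Every directed limit is isomorphic to the one constructed on a quotient of the disjoint union of
the stages, and therefore has the elementary description. -/
theorem IsDirectLimit.isExplicitLimit {f : ∀ i, Hom (A.obj i) L} (hf : A.IsDirectLimit f) :
    A.IsExplicitLimit f := by
  obtain ⟨h, hh, -⟩ := hf.2 A.Limit Limit.hom Limit.isExplicitLimit.compatible
  obtain ⟨g, hg, -⟩ := Limit.isExplicitLimit.isDirectLimit.2 L f hf.1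
  have hgh : g.comp h = Hom.id L := (hf.2 L f hf.1).unique
    (fun i a => (congrArg g (hh i a)).trans (hg i a)) fun _ _ => rfl
  refine ⟨hf.1, fun x => ?_, fun {i a b c} hs => ?_⟩
  · obtain ⟨i, a, ha⟩ := Limit.isExplicitLimit.surj (h x)
    exact ⟨i, a, (hg i a).symm.trans
      ((congrArg g ha).trans (congrArg (fun k => Hom.toFun k x) hgh))⟩
  · refine Limit.isExplicitLimit.isSum ?_
    rw [← hh, ← hh, ← hh]
    exact h.map_isSum hs

end System

end EffectAlgebra

namespace POGroup

variable {G H : Type*} [AddCommGroup G] [PartialOrder G] [IsOrderedAddMonoid G]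
  [AddCommGroup H] [PartialOrder H] [IsOrderedAddMonoid H]

/-! ### Positive tensors -/

theorem tensor_nonneg_iff {x : G ⊗[ℤ] H} : 0 ≤ x ↔ x ∈ tensorCone G H := by
  change x - 0 ∈ tensorCone G H ↔ _
  rw [sub_zero]

theorem tmul_nonneg {a : G} {b : H} (ha : 0 ≤ a) (hb : 0 ≤ b) : 0 ≤ a ⊗ₜ[ℤ] b :=
  tensor_nonneg_iff.2 (AddSubmonoid.subset_closure ⟨a, b, ha, hb, rfl⟩)

theorem tmul_le_tmul {a a' : G} {b b' : H} (ha : 0 ≤ a) (haa' : a ≤ a') (hbb' : b ≤ b')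
    (hb' : 0 ≤ b') : a ⊗ₜ[ℤ] b ≤ a' ⊗ₜ[ℤ] b' := by
  have h : a' ⊗ₜ[ℤ] b' - a ⊗ₜ[ℤ] b = (a' - a) ⊗ₜ[ℤ] b' + a ⊗ₜ[ℤ] (b' - b) := by
    rw [TensorProduct.sub_tmul, TensorProduct.tmul_sub, sub_add_sub_cancel]
  rw [← sub_nonneg, h]
  exact add_nonneg (tmul_nonneg (sub_nonneg.2 haa') hb') (tmul_nonneg ha (sub_nonneg.2 hbb'))

theorem tensor_nonneg_induction {p : G ⊗[ℤ] H → Prop} (zero : p 0)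
    (add : ∀ x y, p x → p y → p (x + y)) (tmul : ∀ a b, 0 ≤ a → 0 ≤ b → p (a ⊗ₜ b))
    {x : G ⊗[ℤ] H} (hx : 0 ≤ x) : p x := by
  refine AddSubmonoid.closure_induction ?_ zero (fun x y _ _ => add x y)
    (tensor_nonneg_iff.1 hx)
  rintro _ ⟨a, b, ha, hb, rfl⟩
  exact tmul a b ha hb

/-- The tensor product of two homomorphisms of abelian groups. -/
noncomputable def tensorMap {G H G' H' : Type*} [AddCommGroup G] [AddCommGroup H]
    [AddCommGroup G'] [AddCommGroup H'] (f : G →+ G') (g : H →+ H') :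
    G ⊗[ℤ] H →+ G' ⊗[ℤ] H' :=
  (TensorProduct.map f.toIntLinearMap g.toIntLinearMap).toAddMonoidHom

theorem tensor_hom_ext {G H K : Type*} [AddCommGroup G] [AddCommGroup H] [AddCommGroup K]
    {f g : G ⊗[ℤ] H →+ K} (h : ∀ a b, f (a ⊗ₜ b) = g (a ⊗ₜ b)) (x : G ⊗[ℤ] H) : f x = g x := by
  induction x with
  | zero => rw [map_zero, map_zero]
  | tmul a b => exact h a b
  | add x y hx hy => rw [map_add, map_add, hx, hy]

theorem tensorMap_tensorMap {G H G' H' G'' H'' : Type*} [AddCommGroup G] [AddCommGroup H]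
    [AddCommGroup G'] [AddCommGroup H'] [AddCommGroup G''] [AddCommGroup H''] (f' : G' →+ G'')
    (g' : H' →+ H'') (f : G →+ G') (g : H →+ H') (x : G ⊗[ℤ] H) :
    tensorMap f' g' (tensorMap f g x) = tensorMap (f'.comp f) (g'.comp g) x :=
  tensor_hom_ext (f := (tensorMap f' g').comp (tensorMap f g))
    (g := tensorMap (f'.comp f) (g'.comp g)) (fun _ _ => rfl) x

theorem tensorMap_id {G H : Type*} [AddCommGroup G] [AddCommGroup H] (x : G ⊗[ℤ] H) :
    tensorMap (AddMonoidHom.id G) (AddMonoidHom.id H) x = x :=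
  tensor_hom_ext (f := tensorMap (AddMonoidHom.id G) (AddMonoidHom.id H)) (g := AddMonoidHom.id _)
    (fun _ _ => rfl) x

theorem tensorMap_nonneg {G' H' : Type*} [AddCommGroup G'] [PartialOrder G']
    [IsOrderedAddMonoid G'] [AddCommGroup H'] [PartialOrder H'] [IsOrderedAddMonoid H']
    {f : G →+ G'} {g : H →+ H'} (hf : ∀ x, 0 ≤ x → 0 ≤ f x) (hg : ∀ x, 0 ≤ x → 0 ≤ g x)
    (x : G ⊗[ℤ] H) (hx : 0 ≤ x) : 0 ≤ tensorMap f g x := by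
  refine tensor_nonneg_induction (p := fun x => 0 ≤ tensorMap f g x) ?_ ?_ ?_ hx
  · rw [map_zero]
  · intro x y hx hy
    rw [map_add]
    exact add_nonneg hx hy
  · exact fun a b ha hb => tmul_nonneg (hf a ha) (hg b hb)

/-- The tensor product of two free abelian groups, in coordinates. -/
theorem exists_tensor_addEquiv {κ μ G H : Type*} [AddCommGroup G] [AddCommGroup H]
    (e : G ≃+ (κ →₀ ℤ)) (f : H ≃+ (μ →₀ ℤ)) :
    ∃ Φ : G ⊗[ℤ] H ≃+ (κ × μ →₀ ℤ), ∀ a b k l, Φ (a ⊗ₜ b) (k, l) = e a k * f b l := by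
  let e' : G ≃ₗ[ℤ] (κ →₀ ℤ) := e.toLinearEquiv fun c x => map_zsmul e c x
  let f' : H ≃ₗ[ℤ] (μ →₀ ℤ) := f.toLinearEquiv fun c x => map_zsmul f c x
  refine ⟨((TensorProduct.congr e' f').trans (finsuppTensorFinsupp' ℤ κ μ)).toAddEquiv,
    fun a b k l => ?_⟩
  simp [e', f']

end POGroup

namespace EffectAlgebra

open POGroup

/-! ### Intervals and simplicial groups -/

section
variable {G H : Type u} [AddCommGroup G] [PartialOrder G] [IsOrderedAddMonoid G]
  [AddCommGroup H] [PartialOrder H] [IsOrderedAddMonoid H]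
  {u : {g : G // 0 ≤ g}} {v : {h : H // 0 ≤ h}}

/-- The morphism of intervals induced by a positive homomorphism that preserves the units. -/
def Interval.map (θ : G →+ H) (hθ : ∀ x, 0 ≤ x → 0 ≤ θ x) (hu : θ u.1 = v.1) :
    Hom (Interval u) (Interval v) where
  toFun x := ⟨θ x.1, hθ _ x.2.1, by
    rw [← sub_nonneg, ← hu, ← map_sub]
    exact hθ _ (sub_nonneg.2 x.2.2)⟩
  map_one := Subtype.ext hu
  map_isSum {a b c} h := ((map_add θ a.1 b.1).symm.trans (congrArg θ h) : θ a.1 + θ b.1 = θ c.1)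

/-- The simple tensor of two elements of intervals. -/
def Interval.tmul (a : Interval u) (b : Interval v) : Interval (tensorUnit u v) :=
  ⟨a.1 ⊗ₜ b.1, tmul_nonneg a.2.1 b.2.1, tmul_le_tmul a.2.1 a.2.2 b.2.2 v.2⟩

theorem Interval.isBimorphism_tmul :
    IsBimorphism (Interval.tmul : Interval u → Interval v → Interval (tensorUnit u v)) where
  left {a b _} q h := (TensorProduct.add_tmul a.1 b.1 q.1).symm.trans
    (congrArg (fun x => x ⊗ₜ[ℤ] q.1) h)
  right {a b _} p h := (TensorProduct.tmul_add p.1 a.1 b.1).symm.trans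
    (congrArg (fun x => p.1 ⊗ₜ[ℤ] x) h)
  map_one := rfl

theorem Interval.isAdditive_hom {K : Type v} [AddCommGroup K] (ψ : G →+ K) :
    IsAdditive fun x : Interval u => ψ x.1 where
  map_zero := map_zero ψ
  map_isSum {a b _} h := (congrArg ψ h).symm.trans (map_add ψ a.1 b.1)

end

/-- Coordinates that identify a partially ordered abelian group with a group `ℤⁿ`, ordered
coordinatewise, such that all coordinates of `u` are positive; that is, `G` is a simplicial group
and `u` is an order unit. -/
structure SimplicialBasis {G : Type u} [AddCommGroup G] [PartialOrder G] [IsOrderedAddMonoid G]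
    (u : {g : G // 0 ≤ g}) where
  κ : Type u
  [fintype : Fintype κ]
  equiv : G ≃+ (κ →₀ ℤ)
  nonneg_iff : ∀ x, 0 ≤ x ↔ 0 ≤ equiv x
  unit_pos : ∀ k, 0 < equiv u.1 k

attribute [instance] SimplicialBasis.fintype

namespace SimplicialBasis
variable {G : Type u} [AddCommGroup G] [PartialOrder G] [IsOrderedAddMonoid G]
  {u : {g : G // 0 ≤ g}} (B : SimplicialBasis u)

theorem le_iff {x y : G} : x ≤ y ↔ B.equiv x ≤ B.equiv y := by
  rw [← sub_nonneg, B.nonneg_iff, map_sub, sub_nonneg]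

/-- The basis elements, which lie below the unit. -/
noncomputable def single (k : B.κ) : Interval u :=
  ⟨B.equiv.symm (Finsupp.single k 1), by
    rw [B.nonneg_iff, AddEquiv.apply_symm_apply]
    exact Finsupp.single_nonneg.2 zero_le_one, by
    classical
    rw [B.le_iff, AddEquiv.apply_symm_apply]
    intro l
    rw [Finsupp.single_apply]
    split_ifs with h
    · exact B.unit_pos l
    · exact (B.unit_pos l).le⟩

theorem equiv_single (k : B.κ) : B.equiv (B.single k).1 = Finsupp.single k 1 :=
  AddEquiv.apply_symm_apply _ _

/-- The coordinates of an element of the interval, as natural numbers. -/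
noncomputable def coord (c : Interval u) (k : B.κ) : ℕ := (B.equiv c.1 k).toNat

theorem coord_cast (c : Interval u) (k : B.κ) : (B.coord c k : ℤ) = B.equiv c.1 k :=
  Int.toNat_of_nonneg ((B.nonneg_iff _).1 c.2.1 k)

theorem coord_zero (k : B.κ) : B.coord 0 k = 0 := by
  have h : B.equiv (0 : Interval u).1 = 0 := map_zero B.equiv
  rw [coord, h]
  rfl

theorem coord_isSum {a b c : Interval u} (h : IsSum a b c) (k : B.κ) :
    B.coord c k = B.coord a k + B.coord b k := by
  have h' : a.1 + b.1 = c.1 := h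
  zify
  rw [coord_cast, coord_cast, coord_cast, ← h', map_add, Finsupp.add_apply]

theorem coord_single [DecidableEq B.κ] (k l : B.κ) :
    B.coord (B.single k) l = if k = l then 1 else 0 := by
  rw [coord, equiv_single, Finsupp.single_apply]
  split_ifs <;> rfl

theorem eq_sum (x : G) : x = ∑ k, B.equiv x k • (B.single k).1 := by
  classical
  apply B.equiv.injective
  rw [map_sum]
  ext l
  simp [equiv_single]

/-- Additive maps on the interval below the unit of a simplicial group are determined by their
values on the basis. -/
theorem additive_eq_sum {M : Type v} [AddCommMonoid M] {γ : Interval u → M} (hγ : IsAdditive γ)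
    (c : Interval u) : γ c = ∑ k, B.coord c k • γ (B.single k) := by
  classical
  induction hn : ∑ k, B.coord c k generalizing c with
  | zero =>
    have h0 : ∀ k, B.coord c k = 0 := by simpa using hn
    have hc : c = 0 := by
      refine Subtype.ext (B.equiv.injective (Finsupp.ext fun k => ?_))
      rw [← coord_cast, ← coord_cast, h0, coord_zero]
    simp [hc, hγ.map_zero, coord_zero]
  | succ n ih =>
    obtain ⟨k, -, hk⟩ : ∃ k ∈ Finset.univ, B.coord c k ≠ 0 := by
      by_contra! h
      rw [Finset.sum_eq_zero h] at hn
      cases hn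
    have hle : (B.single k).1 ≤ c.1 := by
      rw [B.le_iff, equiv_single]
      intro l
      rw [← coord_cast, Finsupp.single_apply]
      split_ifs with h
      · subst h
        exact_mod_cast Nat.one_le_iff_ne_zero.2 hk
      · exact Int.natCast_nonneg _
    let d : Interval u := ⟨c.1 - (B.single k).1, sub_nonneg.2 hle,
      (sub_le_self _ (B.single k).2.1).trans c.2.2⟩
    have hs : IsSum (B.single k) d c := add_sub_cancel (B.single k).1 c.1
    have hd := B.coord_isSum hs
    have hsum : ∑ l, B.coord d l = n := by
      simp only [hd, Finset.sum_add_distrib, coord_single, Finset.sum_ite_eq, Finset.mem_univ,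
        if_true] at hn
      omega
    simp only [hd, hγ.map_isSum hs, ih d hsum, add_smul, Finset.sum_add_distrib, coord_single,
      ite_smul, one_smul, zero_smul, Finset.sum_ite_eq, Finset.mem_univ, if_true]

theorem isAdditive_sum {M : Type v} [AddCommMonoid M] (x : B.κ → M) :
    IsAdditive fun c => ∑ k, B.coord c k • x k where
  map_zero := by simp [coord_zero]
  map_isSum h := by simp [B.coord_isSum h, add_smul, Finset.sum_add_distrib]

theorem hom_ext {K : Type*} [AddCommGroup K] {f g : G →+ K}
    (h : ∀ k, f (B.single k).1 = g (B.single k).1) : f = g := by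
  ext x
  rw [B.eq_sum x]
  simp [h]

theorem hom_nonneg {K : Type*} [AddCommGroup K] [PartialOrder K] [IsOrderedAddMonoid K]
    {f : G →+ K} (h : ∀ k, 0 ≤ f (B.single k).1) (x : G) (hx : 0 ≤ x) : 0 ≤ f x := by
  rw [B.eq_sum x, map_sum]
  refine Finset.sum_nonneg fun k _ => ?_
  rw [map_zsmul]
  exact zsmul_nonneg (h k) ((B.nonneg_iff x).1 hx k)

include B in
theorem exists_extend {K : Type*} [AddCommGroup K] {γ : Interval u → K} (hγ : IsAdditive γ) :
    ∃ f : G →+ K, ∀ c : Interval u, f c.1 = γ c := by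
  let f : G →+ K := (Finsupp.liftAddHom fun k => zmultiplesHom K (γ (B.single k))).comp
    B.equiv.toAddMonoidHom
  have hf : ∀ k, f (B.single k).1 = γ (B.single k) := by
    intro k
    simp [f, equiv_single]
  refine ⟨f, fun c => ?_⟩
  rw [B.additive_eq_sum (Interval.isAdditive_hom f), B.additive_eq_sum hγ]
  simp [hf]

include B in
theorem isSimplicial : IsSimplicial (Interval u) := by
  classical
  constructor
  · have : Finite (Set.Icc 0 (B.equiv u.1)) := (Set.finite_Icc _ _).to_subtype
    refine Finite.of_injective (β := Set.Icc 0 (B.equiv u.1))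
      (fun c => ⟨B.equiv c.1, (B.nonneg_iff _).1 c.2.1, B.le_iff.1 c.2.2⟩) fun c d h => ?_
    exact Subtype.ext (B.equiv.injective (congrArg Subtype.val h))
  · rintro a b b₁ b₂ h ⟨c, hc⟩
    have h' : b₁.1 + b₂.1 = b.1 := h
    have hc' : a.1 + c.1 = b.1 := hc
    let x : G := B.equiv.symm (B.equiv a.1 ⊓ B.equiv b₁.1)
    have hx : B.equiv x = B.equiv a.1 ⊓ B.equiv b₁.1 := AddEquiv.apply_symm_apply _ _
    have hx0 : 0 ≤ x := by
      rw [B.nonneg_iff, hx]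
      exact le_inf ((B.nonneg_iff _).1 a.2.1) ((B.nonneg_iff _).1 b₁.2.1)
    have hxa : x ≤ a.1 := by
      rw [B.le_iff, hx]
      exact inf_le_left
    have hxb : x ≤ b₁.1 := by
      rw [B.le_iff, hx]
      exact inf_le_right
    have hxb' : a.1 - x ≤ b₂.1 := by
      have hab : a.1 ≤ b₁.1 + b₂.1 := by
        rw [h', ← hc']
        exact le_add_of_nonneg_right c.2.1
      rw [sub_le_comm, B.le_iff, hx, map_sub]
      refine le_inf (sub_le_self _ ((B.nonneg_iff _).1 b₂.2.1)) ?_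
      rw [← map_sub, ← B.le_iff, sub_le_iff_le_add]
      exact hab
    let a₁ : Interval u := ⟨x, hx0, hxa.trans a.2.2⟩
    let a₂ : Interval u := ⟨a.1 - x, sub_nonneg.2 hxa, (sub_le_self _ hx0).trans a.2.2⟩
    refine ⟨a₁, a₂, ⟨⟨b₁.1 - x, sub_nonneg.2 hxb, (sub_le_self _ hx0).trans b₁.2.2⟩,
      add_sub_cancel x b₁.1⟩, ⟨⟨b₂.1 - (a.1 - x), sub_nonneg.2 hxb',
      (sub_le_self _ a₂.2.1).trans b₂.2.2⟩, add_sub_cancel (a.1 - x) b₂.1⟩,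
      add_sub_cancel x a.1⟩

/-! ### Tensor products of simplicial groups -/

variable {H : Type u} [AddCommGroup H] [PartialOrder H] [IsOrderedAddMonoid H]
  {v : {h : H // 0 ≤ h}} (C : SimplicialBasis v)

/-- The tensor products of the basis elements form a basis of the tensor product. -/
theorem exists_tensor : ∃ D : SimplicialBasis (tensorUnit u v), ∃ e : D.κ ≃ B.κ × C.κ,
    ∀ a b p, D.equiv (a ⊗ₜ b) p = B.equiv a (e p).1 * C.equiv b (e p).2 := by
  classical
  obtain ⟨Φ, hΦ⟩ := exists_tensor_addEquiv B.equiv C.equiv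
  have key : ∀ k l, Φ ((B.single k).1 ⊗ₜ (C.single l).1) = Finsupp.single (k, l) 1 := by
    intro k l
    ext ⟨k', l'⟩
    rw [hΦ, equiv_single, equiv_single]
    simp only [Finsupp.single_apply, Prod.mk.injEq]
    split_ifs <;> simp_all
  refine ⟨⟨B.κ × C.κ, Φ, fun x => ⟨fun hx => ?_, fun hx => ?_⟩, ?_⟩, Equiv.refl _,
    fun a b p => hΦ a b p.1 p.2⟩
  · refine tensor_nonneg_induction (p := fun x => 0 ≤ Φ x) ?_ ?_ ?_ hx
    · rw [map_zero]
    · intro x y hx hy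
      rw [map_add]
      exact add_nonneg hx hy
    · rintro a b ha hb ⟨k, l⟩
      rw [hΦ]
      exact mul_nonneg ((B.nonneg_iff a).1 ha k) ((C.nonneg_iff b).1 hb l)
  · have hsum : x = ∑ p, Φ x p • ((B.single p.1).1 ⊗ₜ[ℤ] (C.single p.2).1) := by
      apply Φ.injective
      rw [map_sum]
      ext q
      simp [key]
    rw [hsum]
    exact Finset.sum_nonneg fun p _ =>
      zsmul_nonneg (tmul_nonneg (B.single p.1).2.1 (C.single p.2).2.1) (hx p)
  · rintro ⟨k, l⟩
    change 0 < Φ (u.1 ⊗ₜ v.1) (k, l)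
    rw [hΦ]
    exact mul_pos (B.unit_pos k) (C.unit_pos l)

include B C in
/-- A bimorphism `β` extends to the morphism `x ↦ ∑ xₖₗ β(eₖ, eₗ)`, where the `xₖₗ` are the
coordinates of `x`. -/
theorem isTensor_tmul :
    IsTensor (Interval.tmul : Interval u → Interval v → Interval (tensorUnit u v)) := by
  classical
  obtain ⟨D, e, hD⟩ := B.exists_tensor C
  have hcoord : ∀ a b p, D.coord (Interval.tmul a b) p
      = B.coord a (e p).1 * C.coord b (e p).2 := by
    intro a b p
    zify
    rw [coord_cast, coord_cast, coord_cast]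
    exact hD _ _ _
  refine ⟨Interval.isBimorphism_tmul, fun L _ β hβ => ?_⟩
  let γ : Interval (tensorUnit u v) → Total L := fun x =>
    ∑ p, D.coord x p • Total.of (β (B.single (e p).1) (C.single (e p).2))
  have hγ : IsAdditive γ := D.isAdditive_sum _
  have hγβ : ∀ a b, γ (Interval.tmul a b) = Total.of (β a b) := by
    intro a b
    have hl : ∀ k, Total.of (β (B.single k) b)
        = ∑ l, C.coord b l • Total.of (β (B.single k) (C.single l)) := fun k =>
      C.additive_eq_sum (isAdditive_of (f := β (B.single k)) (hβ.right _)) b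
    have hr : Total.of (β a b) = ∑ k, B.coord a k • Total.of (β (B.single k) b) :=
      B.additive_eq_sum (isAdditive_of (f := fun a => β a b) (hβ.left b)) a
    simp only [γ, hcoord]
    rw [hr, e.sum_comp fun p : B.κ × C.κ => (B.coord a p.1 * C.coord b p.2) •
      Total.of (β (B.single p.1) (C.single p.2)), Fintype.sum_prod_type]
    simp only [hl, Finset.smul_sum, mul_smul]
  obtain ⟨φ, hφ⟩ := hγ.exists_hom ((hγβ 1 1).trans (congrArg _ hβ.map_one))
  refine ⟨φ, fun a b => Total.of_injective ((hφ _).trans (hγβ a b)), fun φ' hφ' => ?_⟩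
  have hsingle : ∀ p, D.single p = Interval.tmul (B.single (e p).1) (C.single (e p).2) := by
    intro p
    refine Subtype.ext (D.equiv.injective (Finsupp.ext fun q => ?_))
    rw [← coord_cast, ← coord_cast, hcoord, coord_single, coord_single, coord_single]
    have : p = q ↔ (e p).1 = (e q).1 ∧ (e p).2 = (e q).2 := by
      rw [← Prod.ext_iff, e.apply_eq_iff_eq]
    split_ifs <;> simp_all
  refine Hom.ext' fun x => Total.of_injective ?_
  rw [hφ]
  refine (D.additive_eq_sum (isAdditive_of φ'.map_isSum) x).trans ?_
  simp only [γ, hsingle, hφ']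

end SimplicialBasis

/-! ### Coordinates of finite effect algebras with Riesz decomposition -/

section Atoms
variable {A : Type u} [EffectAlgebra A]

/-- Atoms, that is, nonzero elements that are not sums of two nonzero elements. -/
def IsIrreducibleElement (p : A) : Prop :=
  p ≠ 0 ∧ ∀ a b, IsSum a b p → a = 0 ∨ b = 0

variable (A) in
/-- The type of atoms. -/
def Atoms : Type u := {p : A // IsIrreducibleElement p}

/-- The sum of a multiset of atoms, which may be undefined. -/
noncomputable def atomSum : Multiset (Atoms A) →+ Total A where
  toFun s := (s.map fun p => Total.of p.1).sum
  map_zero' := by simp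
  map_add' s t := by simp

theorem atomSum_apply (s : Multiset (Atoms A)) :
    atomSum s = (s.map fun p => Total.of p.1).sum := rfl

theorem atomSum_cons (p : Atoms A) (s : Multiset (Atoms A)) :
    atomSum (p ::ₘ s) = Total.of p.1 + atomSum s := by
  simp [atomSum_apply]

theorem atomSum_singleton (p : Atoms A) : atomSum {p} = Total.of p.1 := by
  simp [atomSum_apply]

theorem exists_atomSum_eq [Finite A] (a : A) : ∃ s, atomSum s = Total.of a := by
  let r : A → A → Prop := fun x y => ∃ z, z ≠ 0 ∧ IsSum x z y
  have : IsTrans A r := ⟨fun x y z ⟨b, hb, h⟩ ⟨c, _, h'⟩ => by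
    obtain ⟨d, hd, hd'⟩ := isSum_assoc h h'
    refine ⟨d, ?_, hd'⟩
    rintro rfl
    exact hb (eq_zero_of_isSum_zero hd)⟩
  have : Std.Irrefl r := ⟨fun x ⟨z, hz, h⟩ => hz (eq_zero_of_isSum_self h)⟩
  refine (Finite.wellFounded_of_trans_of_irrefl r).induction (C := fun a =>
    ∃ s, atomSum s = Total.of a) a fun a ih => ?_
  by_cases h0 : a = 0
  · exact ⟨0, by rw [h0, map_zero, Total.of_zero]⟩
  by_cases hp : IsIrreducibleElement a
  · exact ⟨_, atomSum_singleton ⟨a, hp⟩⟩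
  · obtain ⟨b, c, h, hb, hc⟩ : ∃ b c, IsSum b c a ∧ b ≠ 0 ∧ c ≠ 0 := by
      simpa [IsIrreducibleElement, h0] using hp
    obtain ⟨s, hs⟩ := ih b ⟨c, hc, h⟩
    obtain ⟨t, ht⟩ := ih c ⟨b, hb, isSum_comm h⟩
    exact ⟨s + t, by rw [map_add, hs, ht, Total.of_add_of.2 h]⟩

theorem eq_zero_of_atomSum_eq_zero {s : Multiset (Atoms A)} (h : atomSum s = Total.of 0) :
    s = 0 := by
  induction s using Multiset.induction with
  | empty => rfl
  | cons p s _ =>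
    rw [atomSum_cons] at h
    obtain ⟨a, b, ha, -, hs⟩ := Total.add_eq_of_iff.1 h
    rw [← Total.of_injective ha] at hs
    exact absurd (eq_zero_of_isSum_zero hs) p.2.1

theorem mem_of_le_atomSum (hA : RieszDecomposition A) (p : Atoms A) {s : Multiset (Atoms A)} {a : A}
    (hs : atomSum s = Total.of a) (hp : Le p.1 a) : p ∈ s := by
  induction s using Multiset.induction generalizing a with
  | empty =>
    obtain ⟨c, hc⟩ := hp
    rw [map_zero] at hs
    rw [← Total.of_injective hs] at hc
    exact absurd (eq_zero_of_isSum_zero hc) p.2.1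
  | cons q s ih =>
    rw [atomSum_cons] at hs
    obtain ⟨q', b, hq, hb, h⟩ := Total.add_eq_of_iff.1 hs
    rw [← Total.of_injective hq] at h
    obtain ⟨a₁, a₂, ⟨c, hc⟩, h₂, h₃⟩ := hA _ _ _ _ h hp
    rcases p.2.2 _ _ h₃ with rfl | rfl
    · rw [isSum_unique (isSum_zero_left a₂) h₃] at h₂
      exact Multiset.mem_cons_of_mem (ih hb h₂)
    · rw [eq_of_isSum_zero h₃] at hc
      have hpq : p = q := by
        rcases q.2.2 _ _ hc with h0 | rfl
        · exact absurd h0 p.2.1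
        · exact Subtype.ext (eq_of_isSum_zero hc)
      rw [hpq]
      exact Multiset.mem_cons_self q s

/-- In the presence of Riesz decomposition, the decomposition of an element into atoms is unique. -/
theorem atomSum_injective (hA : RieszDecomposition A) {s t : Multiset (Atoms A)} {a : A}
    (hs : atomSum s = Total.of a) (ht : atomSum t = Total.of a) : s = t := by
  induction s using Multiset.induction generalizing t a with
  | empty =>
    rw [map_zero] at hs
    rw [← Total.of_injective hs] at ht
    exact (eq_zero_of_atomSum_eq_zero ht).symm
  | cons p s ih =>
    rw [atomSum_cons] at hs
    obtain ⟨p', b, hp, hb, h⟩ := Total.add_eq_of_iff.1 hs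
    rw [← Total.of_injective hp] at h
    obtain ⟨t, rfl⟩ := Multiset.exists_cons_of_mem (mem_of_le_atomSum hA p ht ⟨b, h⟩)
    rw [atomSum_cons] at ht
    obtain ⟨p'', b', hp', hb', h'⟩ := Total.add_eq_of_iff.1 ht
    rw [← Total.of_injective hp'] at h'
    rw [isSum_left_cancel h' h] at hb'
    rw [ih hb hb']

/-- The multiplicities of a multiset, as integers. -/
noncomputable def countHom (κ : Type u) [DecidableEq κ] : Multiset κ →+ (κ →₀ ℤ) :=
  (Finsupp.mapRange.addMonoidHom (Nat.castAddMonoidHom ℤ)).comp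
    (Multiset.toFinsupp (α := κ)).toAddMonoidHom

theorem countHom_apply {κ : Type u} [DecidableEq κ] (s : Multiset κ) (k : κ) :
    countHom κ s k = s.count k := by
  simp [countHom]

theorem countHom_injective (κ : Type u) [DecidableEq κ] : Function.Injective (countHom κ) := by
  intro s t h
  ext k
  have := DFunLike.congr_fun h k
  rw [countHom_apply, countHom_apply] at this
  exact_mod_cast this

theorem countHom_nonneg {κ : Type u} [DecidableEq κ] (s : Multiset κ) : 0 ≤ countHom κ s := by
  intro k
  rw [countHom_apply]
  exact Int.natCast_nonneg _

theorem exists_countHom_eq {κ : Type u} [DecidableEq κ] (x : κ →₀ ℤ) (hx : 0 ≤ x) :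
    ∃ s, countHom κ s = x := by
  refine ⟨Finsupp.toMultiset (x.mapRange Int.toNat rfl), ?_⟩
  ext k
  rw [countHom_apply, Finsupp.count_toMultiset, Finsupp.mapRange_apply]
  exact Int.toNat_of_nonneg (hx k)

/-- A finite effect algebra with the Riesz decomposition property is an interval in a simplicial
group: its elements are uniquely sums of atoms. -/
theorem IsSimplicial.exists_iso (hA : IsSimplicial A) :
    ∃ (κ : Type u) (u : {g : κ →₀ ℤ // 0 ≤ g}), Nonempty (SimplicialBasis u) ∧
      Nonempty (Iso A (Interval u)) := by
  classical
  obtain ⟨hf, hR⟩ := hA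
  choose m hm using exists_atomSum_eq (A := A)
  have hm' : ∀ {a s}, atomSum s = Total.of a → s = m a :=
    fun h => atomSum_injective hR h (hm _)
  have hsum : ∀ {a b c}, IsSum a b c ↔ m a + m b = m c := by
    intro a b c
    rw [← Total.of_add_of, ← hm a, ← hm b, ← map_add]
    exact ⟨hm', fun h => by rw [h, hm]⟩
  let u : {g : Atoms A →₀ ℤ // 0 ≤ g} := ⟨countHom _ (m 1), countHom_nonneg _⟩
  have hle : ∀ a, countHom _ (m a) ≤ u.1 := by
    intro a
    obtain ⟨a', ha', -⟩ := existsUnique_compl a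
    change _ ≤ countHom _ (m 1)
    rw [← hsum.1 ha', map_add]
    exact le_add_of_nonneg_right (countHom_nonneg _)
  have : Finite (Atoms A) := Finite.of_injective (fun p : Atoms A => p.1) Subtype.val_injective
  have hpos : ∀ p, 0 < u.1 p := by
    intro p
    have h1 : m p.1 = {p} := (hm' (atomSum_singleton p)).symm
    refine lt_of_lt_of_le ?_ (hle p.1 p)
    rw [h1, countHom_apply]
    simp
  have := Fintype.ofFinite (Atoms A)
  refine ⟨Atoms A, u, ⟨⟨Atoms A, AddEquiv.refl _, fun _ => Iff.rfl, hpos⟩⟩, ?_⟩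
  let f : A → Interval u := fun a => ⟨countHom _ (m a), countHom_nonneg _, hle a⟩
  have hinj : Function.Injective f := by
    intro a b h
    have h' : m a = m b := countHom_injective _ (congrArg Subtype.val h)
    exact Total.of_injective (by rw [← hm, ← hm, h'])
  have hsurj : Function.Surjective f := by
    rintro ⟨x, hx, hxu⟩
    obtain ⟨s, rfl⟩ := exists_countHom_eq x hx
    obtain ⟨t, ht⟩ := exists_countHom_eq (u.1 - countHom _ s) (sub_nonneg.2 hxu)
    have hst : s + t = m 1 := by
      apply countHom_injective
      rw [map_add, ht]
      exact add_sub_cancel _ _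
    have h1 : atomSum s + atomSum t = Total.of 1 := by rw [← map_add, hst, hm]
    obtain ⟨a, ha⟩ := Total.exists_of_add_eq_of h1
    refine ⟨a, Subtype.ext ?_⟩
    change countHom _ (m a) = countHom _ s
    rw [← hm' ha]
  refine ⟨⟨Equiv.ofBijective f ⟨hinj, hsurj⟩, rfl, fun a b c => ?_⟩⟩
  change countHom _ (m a) + countHom _ (m b) = countHom _ (m c) ↔ _
  rw [hsum, ← map_add]
  exact (countHom_injective _).eq_iff

end Atoms

end EffectAlgebra

namespace POGroup

/-! ### Tensor products and directed limits of abelian groups -/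

/-- Tensor products of abelian groups preserve directed limits, as far as vanishing elements are
concerned: if `G` has the universal property of the limit of the `U i`, an element of `U i ⊗ M` that
vanishes in `G ⊗ M` vanishes at some later stage. By currying, `G ⊗ M` maps to the limit of the
`U i ⊗ M`. -/
theorem exists_tensorMap_eq_zero {I : Type u} [Preorder I] [Nonempty I] [IsDirectedOrder I]
    {U : I → Type u} [∀ i, AddCommGroup (U i)] (θ : ∀ i j, i ≤ j → U i →+ U j)
    (hid : ∀ i x, θ i i le_rfl x = x)
    (hcomp : ∀ i j k (hij : i ≤ j) (hjk : j ≤ k) x,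
      θ j k hjk (θ i j hij x) = θ i k (hij.trans hjk) x)
    {G : Type u} [AddCommGroup G] (φ : ∀ i, U i →+ G)
    (hG : ∀ (K : Type u) [AddCommGroup K] (g : ∀ i, U i →+ K),
      (∀ i j h x, g j (θ i j h x) = g i x) → ∃ ψ : G →+ K, ∀ i x, ψ (φ i x) = g i x)
    (M : Type u) [AddCommGroup M] {i : I} (z : U i ⊗[ℤ] M)
    (hz : tensorMap (φ i) (AddMonoidHom.id M) z = 0) :
    ∃ j, ∃ h : i ≤ j, tensorMap (θ i j h) (AddMonoidHom.id M) z = 0 := by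
  classical
  let W : I → Type u := fun i => U i ⊗[ℤ] M
  let τ : ∀ i j, i ≤ j → W i →+ W j := fun i j h => tensorMap (θ i j h) (AddMonoidHom.id M)
  have : DirectedSystem W fun i j h => τ i j h :=
    { map_self := fun i x => tensor_hom_ext (f := τ i i le_rfl) (g := AddMonoidHom.id _)
        (fun a b => congrArg (fun y => y ⊗ₜ[ℤ] b) (hid i a)) x
      map_map := fun k j i hij hjk x => tensor_hom_ext (f := (τ j k hjk).comp (τ i j hij))
        (g := τ i k (hij.trans hjk))
        (fun a b => congrArg (fun y => y ⊗ₜ[ℤ] b) (hcomp i j k hij hjk a)) x }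
  let D : Type u := AddCommGroup.DirectLimit W τ
  let o : ∀ i, W i →+ D := AddCommGroup.DirectLimit.of W τ
  let g : ∀ i, U i →+ (M →+ D) := fun i => AddMonoidHom.mk'
    (fun a => AddMonoidHom.mk' (fun m => o i (a ⊗ₜ m)) fun m m' => by
      rw [TensorProduct.tmul_add, map_add])
    fun a a' => by
      ext m
      change o i ((a + a') ⊗ₜ m) = o i (a ⊗ₜ m) + o i (a' ⊗ₜ m)
      rw [TensorProduct.add_tmul, map_add]
  obtain ⟨ψ, hψ⟩ := hG (M →+ D) g fun i j h x => by
    ext m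
    exact AddCommGroup.DirectLimit.of_f (G := W) (f := τ) h (x ⊗ₜ[ℤ] m)
  let Ψ : G ⊗[ℤ] M →+ D := TensorProduct.liftAddHom ψ fun r a m => by
    rw [map_zsmul, map_zsmul]
    rfl
  have hΨ : Ψ (tensorMap (φ i) (AddMonoidHom.id M) z) = o i z :=
    tensor_hom_ext (f := Ψ.comp (tensorMap (φ i) (AddMonoidHom.id M))) (g := o i)
      (fun a m => DFunLike.congr_fun (hψ i a) m) z
  rw [hz, map_zero] at hΨ
  exact AddCommGroup.DirectLimit.of.zero_exact (G := W) (f := τ) i z hΨ.symm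

end POGroup

namespace EffectAlgebra

open POGroup

/-! ### Dimension effect algebras and directed limits of simplicial groups -/

/-- A presentation of a partially ordered abelian group with distinguished positive element as the
limit of a directed system of simplicial groups with order units. The field `exact` says that an
element that vanishes in the limit vanishes at some stage, in the form that is stable under tensor
products. -/
structure SimplicialPresentation {G : Type u} [AddCommGroup G] [PartialOrder G]
    [IsOrderedAddMonoid G] (u : {g : G // 0 ≤ g}) where
  I : Type u
  [preorder : Preorder I]
  [nonempty : Nonempty I]
  [directed : IsDirectedOrder I]
  U : I → Type u
  [addCommGroup : ∀ i, AddCommGroup (U i)]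
  [partialOrder : ∀ i, PartialOrder (U i)]
  [isOrderedAddMonoid : ∀ i, IsOrderedAddMonoid (U i)]
  unit : ∀ i, {g : U i // 0 ≤ g}
  basis : ∀ i, SimplicialBasis (unit i)
  map : ∀ i j, i ≤ j → U i →+ U j
  map_nonneg : ∀ {i j} (h : i ≤ j) x, 0 ≤ x → 0 ≤ map i j h x
  map_unit : ∀ {i j} (h : i ≤ j), map i j h (unit i).1 = (unit j).1
  map_id : ∀ i x, map i i le_rfl x = x
  map_comp : ∀ i j k (hij : i ≤ j) (hjk : j ≤ k) x,
    map j k hjk (map i j hij x) = map i k (hij.trans hjk) x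
  hom : ∀ i, U i →+ G
  hom_nonneg : ∀ {i} x, 0 ≤ x → 0 ≤ hom i x
  hom_unit : ∀ i, hom i (unit i).1 = u.1
  hom_map : ∀ {i j} (h : i ≤ j) x, hom j (map i j h x) = hom i x
  exists_nonneg : ∀ g, 0 ≤ g → ∃ i x, 0 ≤ x ∧ hom i x = g
  exists_interval : ∀ g : Interval u, ∃ i, ∃ x : Interval (unit i), hom i x.1 = g.1
  exact : ∀ (M : Type u) [AddCommGroup M] {i} (z : U i ⊗[ℤ] M),
    tensorMap (hom i) (AddMonoidHom.id M) z = 0 →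
      ∃ j, ∃ h : i ≤ j, tensorMap (map i j h) (AddMonoidHom.id M) z = 0

attribute [instance] SimplicialPresentation.preorder SimplicialPresentation.nonempty
  SimplicialPresentation.directed SimplicialPresentation.addCommGroup
  SimplicialPresentation.partialOrder SimplicialPresentation.isOrderedAddMonoid

section
variable {G : Type u} [AddCommGroup G] [PartialOrder G] [IsOrderedAddMonoid G]
  {u : {g : G // 0 ≤ g}}

theorem Hom.isAdditive_val {E : Type u} [EffectAlgebra E] (f : Hom E (Interval u)) :
    IsAdditive fun a => (f a).1 where
  map_zero := congrArg Subtype.val f.map_zero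
  map_isSum h := (f.map_isSum h).symm

/-- The universal group of a dimension effect algebra is a directed limit of simplicial groups. -/
theorem IsUniversalGroup.exists_presentation {E : Type u} [EffectAlgebra E] (hE : IsDimension E)
    {ι : Iso E (Interval u)} (hG : IsUniversalGroup ι) : Nonempty (SimplicialPresentation u) := by
  obtain ⟨I, _, _, _, A, f, hS, hlim⟩ := hE
  have hf := hlim.isExplicitLimit
  choose κ w hB hι using fun i => (hS i).exists_iso
  let B := fun i => (hB i).some
  let e := fun i => (hι i).some
  let t : ∀ i j, i ≤ j → Hom (Interval (w i)) (Interval (w j)) := fun i j h =>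
    (e j).toHom.comp ((A.map h).comp (e i).symm.toHom)
  let s : ∀ i, Hom (Interval (w i)) (Interval u) := fun i =>
    ι.toHom.comp ((f i).comp (e i).symm.toHom)
  have ht : ∀ i j (h : i ≤ j) a, t i j h (e i a) = e j (A.map h a) := fun i j h a =>
    congrArg (fun a => e j (A.map h a)) ((e i).symm_apply_apply a)
  have hs : ∀ i a, s i (e i a) = ι (f i a) := fun i a =>
    congrArg (fun a => ι (f i a)) ((e i).symm_apply_apply a)
  have he : ∀ i x, ∃ a, e i a = x := fun i x => ⟨_, (e i).apply_symm_apply x⟩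
  choose θ hθ using fun i j h => (B i).exists_extend (t i j h).isAdditive_val
  choose φ hφ using fun i => (B i).exists_extend (s i).isAdditive_val
  have hcomp : ∀ i j k (hij : i ≤ j) (hjk : j ≤ k) x,
      θ j k hjk (θ i j hij x) = θ i k (hij.trans hjk) x := by
    intro i j k hij hjk x
    refine DFunLike.congr_fun (?_ : (θ j k hjk).comp (θ i j hij) = θ i k (hij.trans hjk)) x
    refine (B i).hom_ext fun l => ?_
    obtain ⟨a, ha⟩ := he i ((B i).single l)
    rw [AddMonoidHom.comp_apply, ← ha, hθ, hθ, hθ, ht, ht, ht, A.map_comp]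
  have hid : ∀ i x, θ i i le_rfl x = x := by
    intro i x
    refine DFunLike.congr_fun (?_ : θ i i le_rfl = AddMonoidHom.id _) x
    refine (B i).hom_ext fun l => ?_
    obtain ⟨a, ha⟩ := he i ((B i).single l)
    rw [← ha, hθ, ht, A.map_id, AddMonoidHom.id_apply]
  have hφθ : ∀ {i j} (h : i ≤ j) x, φ j (θ i j h x) = φ i x := by
    intro i j h x
    refine DFunLike.congr_fun (?_ : (φ j).comp (θ i j h) = φ i) x
    refine (B i).hom_ext fun l => ?_
    obtain ⟨a, ha⟩ := he i ((B i).single l)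
    rw [AddMonoidHom.comp_apply, ← ha, hθ, ht, hφ, hφ, hs, hs, hf.compatible]
  have hθ0 : ∀ {i j} (h : i ≤ j) x, 0 ≤ x → 0 ≤ θ i j h x := fun {i j} h =>
    (B i).hom_nonneg fun k => by
      rw [hθ]
      exact (t i j h _).2.1
  have hφ0 : ∀ {i} x, 0 ≤ x → 0 ≤ φ i x := fun {i} =>
    (B i).hom_nonneg fun k => by
      rw [hφ]
      exact (s i _).2.1
  have hint : ∀ g : Interval u, ∃ i, ∃ x : Interval (w i), φ i x.1 = g.1 := by
    intro g
    obtain ⟨i, a, ha⟩ := hf.surj (ι.symm g)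
    exact ⟨i, e i a, by rw [hφ, hs, ha, ι.apply_symm_apply]⟩
  -- Measures on `E` are compatible families of homomorphisms on the simplicial groups.
  have huniv : ∀ (K : Type u) [AddCommGroup K] (g : ∀ i, (κ i →₀ ℤ) →+ K),
      (∀ i j h x, g j (θ i j h x) = g i x) → ∃ ψ : G →+ K, ∀ i x, ψ (φ i x) = g i x := by
    intro K _ g hg
    obtain ⟨h, hh⟩ := hf.exists_factor (fun i a => g i (e i a).1) fun hji a => by
      rw [← ht, ← hθ, hg]
    have hm : IsMeasure h := by
      intro x y z hxyz
      obtain ⟨i, a, b, c, rfl, rfl, rfl⟩ := hf.exists_common x y z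
      obtain ⟨j, hij, hs⟩ := hf.isSum hxyz
      rw [← hf.compatible hij, ← hf.compatible hij, ← hf.compatible hij, hh, hh, hh, ← map_add]
      exact congrArg (g j) ((e j).toHom.map_isSum hs).symm
    obtain ⟨ψ, hψ, -⟩ := hG.extend K h hm
    refine ⟨ψ, fun i x => DFunLike.congr_fun (?_ : ψ.comp (φ i) = g i) x⟩
    refine (B i).hom_ext fun l => ?_
    obtain ⟨a, ha⟩ := he i ((B i).single l)
    rw [AddMonoidHom.comp_apply, ← ha, hφ, hs, hψ, hh]
  refine ⟨{ I := I, U := fun i => κ i →₀ ℤ, unit := w, basis := B, map := θ, map_nonneg := hθ0,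
            map_unit := fun {i j} h => ?_, map_id := hid, map_comp := hcomp, hom := φ,
            hom_nonneg := hφ0, hom_unit := fun i => ?_, hom_map := hφθ,
            exists_nonneg := fun g hg => ?_, exists_interval := hint,
            exact := exists_tensorMap_eq_zero θ hid hcomp φ huniv }⟩
  · exact (hθ i j h 1).trans (congrArg Subtype.val (t i j h).map_one)
  · exact (hφ i 1).trans (congrArg Subtype.val (s i).map_one)
  · induction hG.generating g hg using AddSubmonoid.closure_induction with
    | mem x hx =>
      obtain ⟨i, y, hy⟩ := hint ⟨x, hx⟩
      exact ⟨i, y.1, y.2.1, hy⟩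
    | zero =>
      obtain ⟨i⟩ := ‹Nonempty I›
      exact ⟨i, 0, le_rfl, map_zero _⟩
    | add x y hx hy ihx ihy =>
      have hpos : ∀ x ∈ AddSubmonoid.closure {x : G | 0 ≤ x ∧ x ≤ u.1}, 0 ≤ x := fun x hx =>
        (AddSubmonoid.closure_le (S := AddSubmonoid.nonneg G)).2 (fun y hy => hy.1) hx
      obtain ⟨i, a, ha, rfl⟩ := ihx (hpos x hx)
      obtain ⟨j, b, hb, rfl⟩ := ihy (hpos y hy)
      obtain ⟨k, hi, hj⟩ := exists_ge_ge i j
      exact ⟨k, θ i k hi a + θ j k hj b, add_nonneg (hθ0 hi a ha) (hθ0 hj b hb), by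
        rw [map_add, hφθ, hφθ]⟩

end

namespace SimplicialPresentation
variable {G : Type u} [AddCommGroup G] [PartialOrder G] [IsOrderedAddMonoid G]
  {u : {g : G // 0 ≤ g}} {H : Type u} [AddCommGroup H] [PartialOrder H] [IsOrderedAddMonoid H]
  {v : {h : H // 0 ≤ h}} (P : SimplicialPresentation u) (Q : SimplicialPresentation v)

/-! ### The tensor product as a directed limit -/

instance : IsDirectedOrder (P.I × Q.I) where
  directed p q := by
    obtain ⟨i, hi, hi'⟩ := exists_ge_ge p.1 q.1
    obtain ⟨j, hj, hj'⟩ := exists_ge_ge p.2 q.2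
    exact ⟨(i, j), ⟨hi, hj⟩, ⟨hi', hj'⟩⟩

theorem exact_right (M : Type u) [AddCommGroup M] {i : P.I} (z : M ⊗[ℤ] P.U i)
    (hz : tensorMap (AddMonoidHom.id M) (P.hom i) z = 0) :
    ∃ j, ∃ h : i ≤ j, tensorMap (AddMonoidHom.id M) (P.map i j h) z = 0 := by
  have key : ∀ {V W : Type u} [AddCommGroup V] [AddCommGroup W] (f : V →+ W) (z : M ⊗[ℤ] V),
      tensorMap f (AddMonoidHom.id M) (TensorProduct.comm ℤ M V z)
        = TensorProduct.comm ℤ M W (tensorMap (AddMonoidHom.id M) f z) := by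
    intro V W _ _ f z
    exact tensor_hom_ext
      (f := (tensorMap f (AddMonoidHom.id M)).comp (TensorProduct.comm ℤ M V).toAddMonoidHom)
      (g := (TensorProduct.comm ℤ M W).toAddMonoidHom.comp (tensorMap (AddMonoidHom.id M) f))
      (fun _ _ => rfl) z
  obtain ⟨j, h, hj⟩ := P.exact M (TensorProduct.comm ℤ M _ z) (by rw [key, hz, map_zero])
  rw [key, LinearEquiv.map_eq_zero_iff] at hj
  exact ⟨j, h, hj⟩

/-- An element of `U i ⊗ V j` that vanishes in `G ⊗ H` vanishes at some later stage: pass through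
`U i ⊗ H`, one factor at a time. -/
theorem tensor_exact {p : P.I × Q.I} (z : P.U p.1 ⊗[ℤ] Q.U p.2)
    (hz : tensorMap (P.hom p.1) (Q.hom p.2) z = 0) :
    ∃ q, ∃ h : p ≤ q, tensorMap (P.map p.1 q.1 h.1) (Q.map p.2 q.2 h.2) z = 0 := by
  obtain ⟨i, hi, hz⟩ := P.exact H (tensorMap (AddMonoidHom.id _) (Q.hom p.2) z) (by
    rwa [tensorMap_tensorMap, AddMonoidHom.id_comp, AddMonoidHom.comp_id])
  obtain ⟨j, hj, hz⟩ := Q.exact_right (P.U i)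
    (tensorMap (P.map p.1 i hi) (AddMonoidHom.id _) z) (by
      rwa [tensorMap_tensorMap, AddMonoidHom.id_comp, AddMonoidHom.comp_id] at hz ⊢)
  rw [tensorMap_tensorMap, AddMonoidHom.id_comp, AddMonoidHom.comp_id] at hz
  exact ⟨(i, j), ⟨hi, hj⟩, hz⟩

theorem tensorMap_hom_map {p q : P.I × Q.I} (h : p ≤ q) (z : P.U p.1 ⊗[ℤ] Q.U p.2) :
    tensorMap (P.hom q.1) (Q.hom q.2) (tensorMap (P.map p.1 q.1 h.1) (Q.map p.2 q.2 h.2) z)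
      = tensorMap (P.hom p.1) (Q.hom p.2) z := by
  rw [tensorMap_tensorMap]
  congr 1
  congr 1
  · exact AddMonoidHom.ext (P.hom_map _)
  · exact AddMonoidHom.ext (Q.hom_map _)

theorem exists_tensor_nonneg {x : G ⊗[ℤ] H} (hx : 0 ≤ x) :
    ∃ p : P.I × Q.I, ∃ z : P.U p.1 ⊗[ℤ] Q.U p.2, 0 ≤ z ∧
      tensorMap (P.hom p.1) (Q.hom p.2) z = x := by
  refine tensor_nonneg_induction (p := fun x => ∃ p : P.I × Q.I, ∃ z : P.U p.1 ⊗[ℤ] Q.U p.2,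
    0 ≤ z ∧ tensorMap (P.hom p.1) (Q.hom p.2) z = x) ?_ ?_ ?_ hx
  · exact ⟨Classical.arbitrary _, 0, le_rfl, map_zero _⟩
  · rintro _ _ ⟨p, y, hy, rfl⟩ ⟨q, z, hz, rfl⟩
    obtain ⟨r, hp, hq⟩ := exists_ge_ge p q
    exact ⟨r, tensorMap (P.map p.1 r.1 hp.1) (Q.map p.2 r.2 hp.2) y
      + tensorMap (P.map q.1 r.1 hq.1) (Q.map q.2 r.2 hq.2) z,
      add_nonneg (tensorMap_nonneg (P.map_nonneg _) (Q.map_nonneg _) _ hy)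
        (tensorMap_nonneg (P.map_nonneg _) (Q.map_nonneg _) _ hz), by
      rw [map_add, P.tensorMap_hom_map Q hp, P.tensorMap_hom_map Q hq]⟩
  · intro a b ha hb
    obtain ⟨i, a, ha', rfl⟩ := P.exists_nonneg a ha
    obtain ⟨j, b, hb', rfl⟩ := Q.exists_nonneg b hb
    exact ⟨(i, j), a ⊗ₜ b, tmul_nonneg ha' hb', rfl⟩

/-- The system of the unit intervals of the groups `U i ⊗ V j`. -/
noncomputable def tensorSystem : System (P.I × Q.I) where
  obj p := Interval (tensorUnit (P.unit p.1) (Q.unit p.2))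
  map {p q} h := Interval.map (tensorMap (P.map p.1 q.1 h.1) (Q.map p.2 q.2 h.2))
    (tensorMap_nonneg (P.map_nonneg _) (Q.map_nonneg _))
    (congrArg₂ (fun a b => a ⊗ₜ[ℤ] b) (P.map_unit h.1) (Q.map_unit h.2))
  map_id p a := Subtype.ext <| by
    refine Eq.trans ?_ (tensorMap_id a.1)
    change tensorMap _ _ a.1 = _
    congr 1
    congr 1
    · exact AddMonoidHom.ext (P.map_id _)
    · exact AddMonoidHom.ext (Q.map_id _)
  map_comp {p q r} hpq hqr a := Subtype.ext <| by
    refine (tensorMap_tensorMap _ _ _ _ a.1).trans ?_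
    change _ = tensorMap _ _ a.1
    congr 1
    congr 1
    · exact AddMonoidHom.ext (P.map_comp _ _ _ _ _)
    · exact AddMonoidHom.ext (Q.map_comp _ _ _ _ _)

/-- The morphism from the interval of `U i ⊗ V j` to the interval of `G ⊗ H`. -/
noncomputable def tensorHom (p : P.I × Q.I) :
    Hom ((P.tensorSystem Q).obj p) (Interval (tensorUnit u v)) :=
  Interval.map (tensorMap (P.hom p.1) (Q.hom p.2))
    (tensorMap_nonneg P.hom_nonneg Q.hom_nonneg)
    (congrArg₂ (fun a b => a ⊗ₜ[ℤ] b) (P.hom_unit p.1) (Q.hom_unit p.2))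

theorem isExplicitLimit_tensorHom : (P.tensorSystem Q).IsExplicitLimit (P.tensorHom Q) where
  compatible hji a := Subtype.ext (P.tensorMap_hom_map Q hji a.1)
  surj x := by
    -- Lift `x` and `u ⊗ v - x` to positive elements of one stage; at some later stage their sum is
    -- the unit, so that the lift of `x` lies in the interval there.
    obtain ⟨p, y, hy, hyx⟩ := P.exists_tensor_nonneg Q x.2.1
    obtain ⟨q, z, hz, hzx⟩ := P.exists_tensor_nonneg Q (sub_nonneg.2 x.2.2)
    obtain ⟨r, hp, hq⟩ := exists_ge_ge p q
    let y' := tensorMap (P.map p.1 r.1 hp.1) (Q.map p.2 r.2 hp.2) y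
    let z' := tensorMap (P.map q.1 r.1 hq.1) (Q.map q.2 r.2 hq.2) z
    have hy' : 0 ≤ y' := tensorMap_nonneg (P.map_nonneg _) (Q.map_nonneg _) _ hy
    have hz' : 0 ≤ z' := tensorMap_nonneg (P.map_nonneg _) (Q.map_nonneg _) _ hz
    obtain ⟨s, hs, h0⟩ := P.tensor_exact Q
      (y' + z' - (tensorUnit (P.unit r.1) (Q.unit r.2)).1) (by
        rw [map_sub, map_add, P.tensorMap_hom_map Q hp, P.tensorMap_hom_map Q hq, hyx, hzx,
          add_sub_cancel, sub_eq_zero]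
        exact (congrArg Subtype.val (P.tensorHom Q r).map_one).symm)
    rw [map_sub, map_add, sub_eq_zero] at h0
    have h1 : tensorMap (P.map r.1 s.1 hs.1) (Q.map r.2 s.2 hs.2)
        (tensorUnit (P.unit r.1) (Q.unit r.2)).1 = (tensorUnit (P.unit s.1) (Q.unit s.2)).1 :=
      congrArg Subtype.val ((P.tensorSystem Q).map hs).map_one
    refine ⟨s, ⟨tensorMap (P.map r.1 s.1 hs.1) (Q.map r.2 s.2 hs.2) y',
      tensorMap_nonneg (P.map_nonneg _) (Q.map_nonneg _) _ hy', ?_⟩, Subtype.ext ?_⟩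
    · rw [← h1, ← h0]
      exact le_add_of_nonneg_right (tensorMap_nonneg (P.map_nonneg _) (Q.map_nonneg _) _ hz')
    · change tensorMap _ _ _ = x.1
      rw [P.tensorMap_hom_map Q hs, P.tensorMap_hom_map Q hp, hyx]
  isSum {p a b c} h := by
    have h' : tensorMap (P.hom p.1) (Q.hom p.2) a.1 + tensorMap (P.hom p.1) (Q.hom p.2) b.1
      = tensorMap (P.hom p.1) (Q.hom p.2) c.1 := h
    obtain ⟨q, hq, h0⟩ := P.tensor_exact Q (a.1 + b.1 - c.1) (by
      rw [map_sub, map_add, h', sub_self])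
    rw [map_sub, map_add, sub_eq_zero] at h0
    exact ⟨q, hq, h0⟩

include P Q in
theorem isDimension_tensor : IsDimension (Interval (tensorUnit u v)) :=
  ⟨P.I × Q.I, _, inferInstance, inferInstance, P.tensorSystem Q, P.tensorHom Q,
    fun p => ((P.basis p.1).exists_tensor (Q.basis p.2)).choose.isSimplicial,
    (P.isExplicitLimit_tensorHom Q).isDirectLimit⟩

/-- The morphism from the interval of one stage to the interval of the limit. -/
noncomputable def intervalHom (i : P.I) : Hom (Interval (P.unit i)) (Interval u) :=
  Interval.map (P.hom i) P.hom_nonneg (P.hom_unit i)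

theorem intervalHom_map {i j : P.I} (h : i ≤ j) (x : Interval (P.unit i)) :
    P.intervalHom j (Interval.map (P.map i j h) (P.map_nonneg h) (P.map_unit h) x)
      = P.intervalHom i x :=
  Subtype.ext (P.hom_map h x.1)

include P Q in
/-- A bimorphism on the limit restricts to bimorphisms on the stages, and the morphisms that these
induce on the tensor products of the stages are compatible. -/
theorem isTensor_tmul :
    IsTensor (Interval.tmul : Interval u → Interval v → Interval (tensorUnit u v)) := by
  have hlim := (P.isExplicitLimit_tensorHom Q).isDirectLimit
  have hstage := fun p : P.I × Q.I => (P.basis p.1).isTensor_tmul (Q.basis p.2)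
  refine ⟨Interval.isBimorphism_tmul, fun L _ β hβ => ?_⟩
  have hβ' : ∀ p : P.I × Q.I, IsBimorphism fun (a : Interval (P.unit p.1))
      (b : Interval (Q.unit p.2)) => β (P.intervalHom p.1 a) (Q.intervalHom p.2 b) := fun p =>
    { left := fun q h => hβ.left _ ((P.intervalHom p.1).map_isSum h)
      right := fun q h => hβ.right _ ((Q.intervalHom p.2).map_isSum h)
      map_one := by
        rw [(P.intervalHom p.1).map_one, (Q.intervalHom p.2).map_one]
        exact hβ.map_one }
  choose g hg hg' using fun p => (hstage p).2 L _ (hβ' p)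
  have hcompat : (P.tensorSystem Q).Compatible g := by
    intro p q h a
    have := ((hstage p).2 L _ (hβ' p)).unique
      (y₁ := (g q).comp ((P.tensorSystem Q).map h)) (y₂ := g p) (fun a b => ?_) (hg p)
    · exact congrArg (fun k => Hom.toFun k a) this
    · refine (hg q (Interval.map _ (P.map_nonneg h.1) (P.map_unit h.1) a)
        (Interval.map _ (Q.map_nonneg h.2) (Q.map_unit h.2) b)).trans ?_
      rw [intervalHom_map, intervalHom_map]
  obtain ⟨φ, hφ, hφ'⟩ := hlim.2 L g hcompat
  refine ⟨φ, fun a b => ?_, fun φ₂ hφ₂ => hφ' φ₂ fun p a => ?_⟩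
  · obtain ⟨i, x, hx⟩ := P.exists_interval a
    obtain ⟨j, y, hy⟩ := Q.exists_interval b
    have hx' : P.intervalHom i x = a := Subtype.ext hx
    have hy' : Q.intervalHom j y = b := Subtype.ext hy
    subst hx' hy'
    exact (hφ (i, j) (Interval.tmul x y)).trans (hg (i, j) x y)
  · have := hg' p (φ₂.comp (P.tensorHom Q p)) fun a b =>
      hφ₂ (P.intervalHom p.1 a) (Q.intervalHom p.2 b)
    exact congrArg (fun k => Hom.toFun k a) this

end SimplicialPresentation

/-- The universal property of a tensor product is invariant under isomorphisms of the factors. -/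
theorem IsTensor.comp_iso {E F E' F' T : Type u} [EffectAlgebra E] [EffectAlgebra F]
    [EffectAlgebra E'] [EffectAlgebra F'] [EffectAlgebra T] {τ : E' → F' → T} (h : IsTensor τ)
    (e : Iso E E') (f : Iso F F') : IsTensor fun a b => τ (e a) (f b) := by
  refine ⟨⟨fun q hs => h.1.left _ (e.toHom.map_isSum hs),
    fun p hs => h.1.right _ (f.toHom.map_isSum hs), ?_⟩, fun L _ β hβ => ?_⟩
  · exact (congrArg₂ τ e.map_one f.map_one).trans h.1.map_one
  · obtain ⟨φ, hφ, hφ'⟩ := h.2 L (fun a b => β (e.symm a) (f.symm b))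
      ⟨fun q hs => hβ.left _ (e.symm.toHom.map_isSum hs),
        fun p hs => hβ.right _ (f.symm.toHom.map_isSum hs),
        (congrArg₂ β e.symm.map_one f.symm.map_one).trans hβ.map_one⟩
    refine ⟨φ, fun a b => ?_, fun φ₂ hφ₂ => hφ' φ₂ fun a b => ?_⟩
    · rw [hφ, e.symm_apply_apply, f.symm_apply_apply]
    · have := hφ₂ (e.symm a) (f.symm b)
      beta_reduce at this
      rwa [e.apply_symm_apply, f.apply_symm_apply] at this

end EffectAlgebra

theorem mainTheorem1 {E F : Type u} [EffectAlgebra E] [EffectAlgebra F]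
    (hE : EffectAlgebra.IsDimension E) (hF : EffectAlgebra.IsDimension F)
    {G : Type u} [AddCommGroup G] [PartialOrder G] [IsOrderedAddMonoid G]
    {H : Type u} [AddCommGroup H] [PartialOrder H] [IsOrderedAddMonoid H]
    {uE : {g : G // 0 ≤ g}} {uF : {h : H // 0 ≤ h}}
    (ιE : EffectAlgebra.Iso E (EffectAlgebra.Interval uE))
    (ιF : EffectAlgebra.Iso F (EffectAlgebra.Interval uF))
    (hG : EffectAlgebra.IsUniversalGroup ιE) (hH : EffectAlgebra.IsUniversalGroup ιF) :
    (∃ τ : E → F → EffectAlgebra.Interval (POGroup.tensorUnit uE uF),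
      (∀ a b, (τ a b).1 = (ιE a).1 ⊗ₜ[ℤ] (ιF b).1) ∧ EffectAlgebra.IsTensor τ) ∧
    EffectAlgebra.IsDimension (EffectAlgebra.Interval (POGroup.tensorUnit uE uF)) ∧
    ∀ (T : Type u) [EffectAlgebra T] (t : E → F → T), EffectAlgebra.IsTensor t →
      EffectAlgebra.IsDimension T ∧
      ∃ φ : EffectAlgebra.Iso T (EffectAlgebra.Interval (POGroup.tensorUnit uE uF)),
        ∀ a b, (φ (t a b)).1 = (ιE a).1 ⊗ₜ[ℤ] (ιF b).1 := by
  obtain ⟨P⟩ := hG.exists_presentation hE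
  obtain ⟨Q⟩ := hH.exists_presentation hF
  have hτ := (P.isTensor_tmul Q).comp_iso ιE ιF
  have hdim := P.isDimension_tensor Q
  refine ⟨⟨_, fun _ _ => rfl, hτ⟩, hdim, fun T _ t ht => ?_⟩
  obtain ⟨φ, hφ⟩ := ht.exists_iso hτ
  exact ⟨hdim.of_iso φ.symm, φ, fun a b => congrArg Subtype.val (hφ a b)⟩
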